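/- **Lemma 5 (Box dimension of the singularity at infinity in chart 2).** Let $a,b\in\mathbb R\setminus\{0\}$, let $m\ge 2$ be even, let $n\in\mathbb N$ with $m<2n+1$, and consider the cusp system $$\dot x=y,\qquad \dot y=ax^m+bx^ny .$$ In the coordinates of the second chart at infinity, $x=u/v$, $y=1/v$, after multiplication by $v^n$, it becomes $$\dot u=v^n-au^{m+1}v^{n+1-m}-bu^{n+1},\qquad \dot v=-au^mv^{n-m+2}-bu^nv, \tag{$*$}$$ (a polynomial vector field when $m\le n+1$), and points at infinity have $v=0$. By a separatrix at infinity we mean a half-trajectory $\Gamma\subset\{v\neq0\}$ of $(*)$ that tends to the origin $(u,v)=(0,0)$ in forward or in backward time, with asymptotics $|v|\simeq|u|^{\frac{n+1}{n}}$ (i.e. the quotient of the two sides lies between two positive constants on $\Gamma$ near the origin). Let $U$ be the unit-time map of $(*)$ if $\Gamma$ tends to the origin in forward time, and the unit-time map of the time-reversed system (the inverse of the unit-time map of $(*)$) otherwise. Then: 1. At least one such separatrix exists. 2. For every such separatrix $\Gamma$ and every $p\in\Gamma$, the orbit $S^2_\infty=\{U^k(p):k=0,1,2,\dots\}\subset\mathbb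 R^2$ has (Minkowski) box dimension $$\dim_BS^2_\infty=1-\frac1{n+1}.$$ 3. For every such separatrix the multiplicity at infinity is $k=\lfloor n/2\rfloor$. Here the multiplicity is said to be $k$ if the first component of $U$ on $\Gamma$ has the form $U_1(u,v)=u+c\,u^N+o(u^N)$ as $(u,v)\to(0,0)$ along $\Gamma$, with $c\ne0$ and $N\in\{2k+1,2k+2\}$; the statement is that this holds for $k=\lfloor n/2\rfloor$ and for no other $k\in\mathbb N$. The lower and upper box dimensions of a bounded $A\subset\mathbb R^N$ are $\inf\{s>0:\mathcal M^s(A)=0\}$, where $\mathcal M^s(A)$ is the $\liminf$, respectively $\limsup$, as $\varepsilon\to0^+$ of $|A_\varepsilon|/\varepsilon^{N-s}$, with $A_\varepsilon$ the open $\varepsilon$-neighbourhood of $A$ and $|\cdot|$ the Lebesgue measure; the box dimension is their common value. -/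

import Mathlib

open Filter Topology MeasureTheory Set Asymptotics

noncomputable section

/-! ### Minkowski contents and box dimension -/

/-- The lower `s`-dimensional Minkowski content of `A ⊆ ℝᴺ`, with values in `[0, ∞]`. -/
def lowerMinkowskiContent {N : ℕ} (s : ℝ) (A : Set (EuclideanSpace ℝ (Fin N))) : ENNReal :=
  liminf (fun ε : ℝ => volume (Metric.thickening ε A) / ENNReal.ofReal (ε ^ ((N : ℝ) - s)))
    (𝓝[>] (0 : ℝ))

/-- The upper `s`-dimensional Minkowski content of `A ⊆ ℝᴺ`, with values in `[0, ∞]`. -/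
def upperMinkowskiContent {N : ℕ} (s : ℝ) (A : Set (EuclideanSpace ℝ (Fin N))) : ENNReal :=
  limsup (fun ε : ℝ => volume (Metric.thickening ε A) / ENNReal.ofReal (ε ^ ((N : ℝ) - s)))
    (𝓝[>] (0 : ℝ))

/-- The lower box dimension. -/
def lowerBoxDim {N : ℕ} (A : Set (EuclideanSpace ℝ (Fin N))) : ℝ :=
  sInf {s : ℝ | 0 < s ∧ lowerMinkowskiContent s A = 0}

/-- The upper box dimension. -/
def upperBoxDim {N : ℕ} (A : Set (EuclideanSpace ℝ (Fin N))) : ℝ :=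
  sInf {s : ℝ | 0 < s ∧ upperMinkowskiContent s A = 0}

/-- The set `A` is bounded, its box dimension exists, and it is equal to `d`. -/
def HasBoxDim {N : ℕ} (A : Set (EuclideanSpace ℝ (Fin N))) (d : ℝ) : Prop :=
  Bornology.IsBounded A ∧ lowerBoxDim A = d ∧ upperBoxDim A = d

/-! ### The unit-time map of a planar vector field -/

/-- The plane. -/
abbrev Plane : Type := EuclideanSpace ℝ (Fin 2)

open Classical in
/-- The unit-time map of the vector field `X`: the position at time `1` of the solution of
`γ' = X(γ)` that starts in `p` at time `0` (the junk value is `p` where there is no such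
solution on `[0, 1]`). -/
def unitTimeMap (X : Plane → Plane) (p : Plane) : Plane :=
  if h : ∃ γ : ℝ → Plane, γ 0 = p ∧ IsIntegralCurveOn γ (fun _ => X) (Icc 0 1) then
    h.choose 1
  else p

/-- The orbit `{p, U p, U (U p), …}` of `p` under a map `U` of the plane. -/
def orbitSet (U : Plane → Plane) (p : Plane) : Set Plane :=
  range fun k : ℕ => U^[k] p

/-! ### The cusp system and its second Poincaré chart -/

/-- The vector field of the system `x' = y`, `y' = a xᵐ + b xⁿ y`. -/
def cuspField (a b : ℝ) (m n : ℕ) (p : Plane) : Plane :=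
  !₂[p 1, a * p 0 ^ m + b * p 0 ^ n * p 1]

/-- The coordinates `(u, v) = (x / y, 1 / y)` of the second chart, i.e. `x = u / v`, `y = 1 / v`.
Points at infinity have `v = 0`. -/
def toChart2 (p : Plane) : Plane :=
  !₂[p 0 / p 1, 1 / p 1]

/-- The vector field at infinity in the second chart, i.e. the cusp field in the coordinates
`(u, v)`, multiplied by `vⁿ`:
`u' = vⁿ - a uᵐ⁺¹ vⁿ⁺¹⁻ᵐ - b uⁿ⁺¹`, `v' = - a uᵐ vⁿ⁻ᵐ⁺² - b uⁿ v`.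
The exponents of `v` are integers; for `m ≤ n + 1` they are non-negative, and the field is
polynomial in the whole plane. -/
def chart2Field (a b : ℝ) (m n : ℕ) (p : Plane) : Plane :=
  !₂[p 1 ^ n - a * p 0 ^ (m + 1) * p 1 ^ ((n : ℤ) + 1 - m) - b * p 0 ^ (n + 1),
     -a * p 0 ^ m * p 1 ^ ((n : ℤ) - m + 2) - b * p 0 ^ n * p 1]

/-- A solution of the cusp system, read in the second chart, is tangent to `v⁻ⁿ • chart2Field`
(recall that `v⁻¹ = y`). -/
theorem hasDerivAt_toChart2 (a b : ℝ) (m n : ℕ) (γ : ℝ → Plane) (t : ℝ) (hy : γ t 1 ≠ 0)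
    (h : HasDerivAt γ (cuspField a b m n (γ t)) t) :
    HasDerivAt (fun s => toChart2 (γ s))
      ((γ t 1) ^ n • chart2Field a b m n (toChart2 (γ t))) t := by
  have key : ∀ (f : ℝ → Plane) (f' : Plane),
      HasDerivAt f f' t ↔ ∀ i, HasDerivAt (fun s => f s i) (f' i) t := by
    intro f f'
    rw [← hasDerivWithinAt_univ, hasDerivWithinAt_iff_hasFDerivWithinAt,
      hasFDerivWithinAt_euclidean]
    refine forall_congr' fun i => ?_
    rw [← hasDerivWithinAt_univ, hasDerivWithinAt_iff_hasFDerivWithinAt]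
    refine iff_of_eq ?_
    congr 1
  rw [key] at h ⊢
  have h0 := h 0
  have h1 := h 1
  simp only [cuspField, PiLp.toLp_apply, Matrix.cons_val_zero, Matrix.cons_val_one] at h0 h1
  have e1 : ((γ t 1)⁻¹ : ℝ) ^ ((n : ℤ) + 1 - m) = (γ t 1)⁻¹ ^ n * (γ t 1)⁻¹ * (γ t 1) ^ m := by
    rw [zpow_sub₀ (inv_ne_zero hy), zpow_add₀ (inv_ne_zero hy)]
    simp
  have e2 : ((γ t 1)⁻¹ : ℝ) ^ ((n : ℤ) - m + 2) = (γ t 1)⁻¹ ^ n * (γ t 1) ^ m * (γ t 1)⁻¹ ^ 2 := by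
    rw [zpow_add₀ (inv_ne_zero hy), zpow_sub₀ (inv_ne_zero hy)]
    simp
  intro i
  fin_cases i
  · have := h0.div h1 hy
    simp only [toChart2, chart2Field, PiLp.smul_apply, PiLp.toLp_apply, Fin.zero_eta,
      Matrix.cons_val_zero, Matrix.cons_val_one, smul_eq_mul, one_div]
    refine this.congr_deriv ?_
    rw [e1]
    simp only [inv_pow, div_pow]
    field_simp
    ring
  · have := h1.inv hy
    simp only [toChart2, chart2Field, PiLp.smul_apply, PiLp.toLp_apply, Fin.mk_one,
      Matrix.cons_val_zero, Matrix.cons_val_one, smul_eq_mul, one_div]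
    refine this.congr_deriv ?_
    rw [e2]
    simp only [inv_pow, div_pow]
    field_simp
    ring

/-! ### Separatrices at infinity and multiplicity -/

/-- `Γ` is a positive half-trajectory of the vector field `X` that tends to the origin in the
region `v ≠ 0` (that is, it consists of finite points of the original phase plane and tends to a
point at infinity), with the asymptotics `|v| ≃ |u| ^ ((n + 1) / n)`. -/
def IsSeparatrixToInfinity (X : Plane → Plane) (n : ℕ) (Γ : Set Plane) : Prop :=
  ∃ γ : ℝ → Plane,
    IsIntegralCurveOn γ (fun _ => X) (Ici 0) ∧
    (∀ t ∈ Ici (0 : ℝ), γ t 1 ≠ 0) ∧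
    Tendsto γ atTop (𝓝 0) ∧
    Γ = γ '' Ici 0 ∧
    (fun p : Plane => p 1) =Θ[𝓝[Γ] 0] (fun p : Plane => |p 0| ^ (((n : ℝ) + 1) / n))

/-- On the curve `Γ`, as the point tends to the origin, the first component of `U` has the form
`U₁ = u + c u ^ N + o(u ^ N)` with `c ≠ 0`. -/
def HasDisplacementOrder (U : Plane → Plane) (Γ : Set Plane) (N : ℕ) : Prop :=
  ∃ c : ℝ, c ≠ 0 ∧ Tendsto (fun p : Plane => (U p 0 - p 0) / p 0 ^ N) (𝓝[Γ] 0) (𝓝 c)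

/-- The origin has multiplicity `k` for the map `U` on the curve `Γ`: the displacement
`U₁ - u` has order `2 k + 1` or `2 k + 2`. -/
def HasMultiplicity (U : Plane → Plane) (Γ : Set Plane) (k : ℕ) : Prop :=
  HasDisplacementOrder U Γ (2 * k + 1) ∨ HasDisplacementOrder U Γ (2 * k + 2)

end

/-! Write E = a x^(m-n) / y (`cuspPerturbation`). Where u, v ≠ 0 the field is u' = v^n - u^(n+1) (E
+ b), v' = -u^n v (E + b). Along a separatrix v^n ≍ u^(n+1), which makes E^n = O(u^(2n+1-m)); since
m < 2n+1, E tends to 0. In the original coordinates dy / d(x^(n+1)) = (b + E) / (n+1), and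
L'Hôpital's rule gives v^n / u^(n+1) = y / x^(n+1) → b / (n+1) (`tendsto_chart2_slope`).

Up to the direction of time, therefore, u' ~ -(b n / (n+1)) u^(n+1). So |u| decays like t^(-1/n),
and the displacement of u over a unit of time is asymptotic to a nonzero multiple of u^(n+1)
(`tendsto_decay_displacement`). The order n+1 lies in {2k+1, 2k+2} exactly for k = ⌊n/2⌋. Near the
origin v is a Lipschitz function of u on the curve, so an orbit has the dimension of a real sequence
of size k^(-1/n) with gaps of size k^(-1-1/n), namely 1 / (1 + 1/n) (`hasBoxDim_range_of_gaps`).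

For existence, `exists_cusp_orbit` finds an orbit as a graph over large x, a perturbation of y = B
x^(n+1) with B = |b| / (n+1). A reflection by the sign of b and a change of time
(`exists_time_change`) turn it into a half-trajectory in the chart. -/

/-! ### Box dimension from volume estimates and from gaps of sequences. -/

/-- Two-sided power bounds for the volume of the `ε`-neighbourhoods determine the box dimension. -/
theorem hasBoxDim_of_volume_bounds {N : ℕ} {A : Set (EuclideanSpace ℝ (Fin N))} {d c C : ℝ}
    (hd : 0 < d) (hc : 0 < c) (hA : Bornology.IsBounded A)
    (hlow : ∀ᶠ ε : ℝ in 𝓝[>] 0,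
      ENNReal.ofReal (c * ε ^ ((N : ℝ) - d)) ≤ volume (Metric.thickening ε A))
    (hupp : ∀ᶠ ε : ℝ in 𝓝[>] 0,
      volume (Metric.thickening ε A) ≤ ENNReal.ofReal (C * ε ^ ((N : ℝ) - d))) :
    HasBoxDim A d := by
  have hpos : ∀ᶠ ε : ℝ in 𝓝[>] 0, 0 < ε := self_mem_nhdsWithin
  have hone : ∀ᶠ ε : ℝ in 𝓝[>] 0, ε < 1 :=
    eventually_nhdsWithin_of_eventually_nhds (gt_mem_nhds one_pos)
  have hsmall : ∀ s : ℝ, d < s → Tendsto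
      (fun ε : ℝ => volume (Metric.thickening ε A) / ENNReal.ofReal (ε ^ ((N : ℝ) - s)))
      (𝓝[>] (0 : ℝ)) (𝓝 0) := by
    intro s hs
    have h0 : Tendsto (fun ε : ℝ => ENNReal.ofReal (C * ε ^ (s - d))) (𝓝[>] (0 : ℝ)) (𝓝 0) := by
      have h1 : Tendsto (fun ε : ℝ => C * ε ^ (s - d)) (𝓝[>] (0 : ℝ)) (𝓝 0) := by
        have := (Real.continuousAt_rpow_const 0 (s - d) (Or.inr (by linarith))).tendsto
        rw [Real.zero_rpow (by linarith)] at this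
        simpa using (this.mono_left nhdsWithin_le_nhds).const_mul C
      simpa using ENNReal.tendsto_ofReal h1
    refine tendsto_of_tendsto_of_tendsto_of_le_of_le' tendsto_const_nhds h0
      (Eventually.of_forall fun _ => bot_le) ?_
    filter_upwards [hupp, hpos] with ε h hε
    have hε' := Real.rpow_pos_of_pos hε ((N : ℝ) - s)
    refine ENNReal.div_le_of_le_mul (h.trans_eq ?_)
    rw [← ENNReal.ofReal_mul' hε'.le, mul_assoc, ← Real.rpow_add hε]
    congr 3
    ring
  have hlarge : ∀ s : ℝ, s ≤ d → ENNReal.ofReal c ≤ lowerMinkowskiContent s A := by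
    intro s hs
    refine le_liminf_of_le (by isBoundedDefault) ?_
    filter_upwards [hlow, hpos, hone] with ε h hε hε1
    have hε' := Real.rpow_pos_of_pos hε ((N : ℝ) - s)
    rw [ENNReal.le_div_iff_mul_le (Or.inl (by simpa using hε')) (Or.inl ENNReal.ofReal_ne_top)]
    refine le_trans ?_ h
    rw [← ENNReal.ofReal_mul hc.le]
    refine ENNReal.ofReal_le_ofReal (mul_le_mul_of_nonneg_left ?_ hc.le)
    exact Real.rpow_le_rpow_of_exponent_ge hε hε1.le (by linarith)
  have hle : ∀ s : ℝ, lowerMinkowskiContent s A ≤ upperMinkowskiContent s A :=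
    fun s => liminf_le_limsup
  have hcpos : 0 < ENNReal.ofReal c := by simpa using hc
  -- Both contents vanish precisely above `d`. As `0 < d`, the restriction to positive exponents
  -- removes nothing from `Ioi d`.
  have e1 : {s : ℝ | 0 < s ∧ lowerMinkowskiContent s A = 0} = Ioi d := by
    ext s
    refine ⟨fun h => ?_, fun h => ⟨hd.trans h, (hsmall s h).liminf_eq⟩⟩
    by_contra hs
    exact (hcpos.trans_le (hlarge s (not_lt.1 hs))).ne' h.2
  have e2 : {s : ℝ | 0 < s ∧ upperMinkowskiContent s A = 0} = Ioi d := by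
    ext s
    refine ⟨fun h => ?_, fun h => ⟨hd.trans h, (hsmall s h).limsup_eq⟩⟩
    by_contra hs
    exact (hcpos.trans_le ((hlarge s (not_lt.1 hs)).trans (hle s))).ne' h.2
  exact ⟨hA, by rw [lowerBoxDim, e1, csInf_Ioi], by rw [upperBoxDim, e2, csInf_Ioi]⟩

theorem volume_plane_ball (x : Plane) {r : ℝ} (hr : 0 ≤ r) :
    volume (Metric.ball x r) = ENNReal.ofReal (Real.pi * r ^ 2) := by
  rw [EuclideanSpace.volume_ball_fin_two, mul_comm Real.pi, ENNReal.ofReal_mul (by positivity),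
    ENNReal.ofReal_pow hr]

/-- If a sequence splits into at most `M` classes of diameter at most `L * ε`, the
`ε`-neighbourhood of its range is covered by `M` discs of radius `(L + 1) * ε`. -/
theorem volume_thickening_range_le {p : ℕ → Plane} {ε L : ℝ} (hε : 0 < ε) (hL : 0 ≤ L) {M : ℕ}
    (cl : ℕ → ℕ) (hcl : ∀ k, cl k < M) (hdist : ∀ j k, cl j = cl k → dist (p j) (p k) ≤ L * ε) :
    volume (Metric.thickening ε (range p)) ≤
      ENNReal.ofReal (M * (Real.pi * ((L + 1) * ε) ^ 2)) := by
  classical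
  -- An empty class gets the representative 0; its disc is superfluous and harmless for an upper
  -- bound.
  set rep : ℕ → ℕ := fun i => if h : ∃ k, cl k = i then h.choose else 0 with hrep
  have hrep' : ∀ k, cl (rep (cl k)) = cl k := by
    intro k
    have h : ∃ j, cl j = cl k := ⟨k, rfl⟩
    simp only [hrep, dif_pos h]
    exact h.choose_spec
  have hsub : Metric.thickening ε (range p) ⊆
      ⋃ i ∈ Finset.range M, Metric.ball (p (rep i)) ((L + 1) * ε) := by
    intro z hz
    obtain ⟨_, ⟨k, rfl⟩, hk⟩ := Metric.mem_thickening_iff.1 hz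
    simp only [mem_iUnion, Finset.mem_range]
    refine ⟨cl k, hcl k, ?_⟩
    have := hdist k (rep (cl k)) (hrep' k).symm
    have := dist_triangle z (p k) (p (rep (cl k)))
    rw [Metric.mem_ball]
    linarith
  refine (measure_mono hsub).trans ((measure_biUnion_finset_le _ _).trans ?_)
  have : 0 ≤ (L + 1) * ε := by positivity
  simp_rw [volume_plane_ball _ this]
  rw [Finset.sum_const, Finset.card_range, nsmul_eq_mul, ENNReal.ofReal_mul (Nat.cast_nonneg M),
    ENNReal.ofReal_natCast]

/-- The `ε`-neighbourhood of a set with `M` points at mutual distances at least `2 * ε`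
contains `M` disjoint discs of radius `ε`. -/
theorem le_volume_thickening {A : Set Plane} {ε : ℝ} (hε : 0 < ε) (s : Finset ℕ) {p : ℕ → Plane}
    (hA : ∀ k ∈ s, p k ∈ A)
    (hdist : ∀ j ∈ s, ∀ k ∈ s, j < k → 2 * ε ≤ dist (p j) (p k)) :
    ENNReal.ofReal (s.card * (Real.pi * ε ^ 2)) ≤ volume (Metric.thickening ε A) := by
  have hdisj : (s : Set ℕ).PairwiseDisjoint fun k => Metric.ball (p k) ε := by
    intro j hj k hk hjk
    refine Metric.ball_disjoint_ball ?_
    rcases lt_or_gt_of_ne hjk with h | h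
    · linarith [hdist j hj k hk h]
    · rw [dist_comm]; linarith [hdist k hk j hj h]
  have hsub : ⋃ k ∈ s, Metric.ball (p k) ε ⊆ Metric.thickening ε A := by
    intro z hz
    simp only [mem_iUnion] at hz
    obtain ⟨k, hk, hz⟩ := hz
    exact Metric.mem_thickening_iff.2 ⟨p k, hA k hk, hz⟩
  refine le_trans (le_of_eq ?_) (measure_mono hsub)
  rw [measure_biUnion_finset hdisj fun _ _ => Metric.isOpen_ball.measurableSet]
  simp_rw [volume_plane_ball _ hε.le]
  rw [Finset.sum_const, nsmul_eq_mul, ENNReal.ofReal_mul (by positivity),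
    ENNReal.ofReal_natCast]

/-- A sequence in the plane that is bi-Lipschitz equivalent to a decreasing sequence `r` of reals
with `r k ≲ k ^ (-α)` and gaps `≳ k ^ (-1 - α)` has box dimension `1 / (1 + α)`. -/
theorem hasBoxDim_range_of_gaps {p : ℕ → Plane} {r : ℕ → ℝ} {α C c L : ℝ} {K : ℕ}
    (hα : 0 < α) (hC : 0 < C) (hc : 0 < c) (hL : 0 ≤ L)
    (h0 : ∀ k, K ≤ k → 0 ≤ r k)
    (h1 : ∀ k, K ≤ k → 0 < k → r k ≤ C * (k : ℝ) ^ (-α))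
    (h2 : ∀ k, K ≤ k → 0 < k → c * (k : ℝ) ^ (-(1 + α)) ≤ r k - r (k + 1))
    (h3 : ∀ j k, K ≤ j → K ≤ k → |r j - r k| ≤ dist (p j) (p k))
    (h4 : ∀ j k, K ≤ j → K ≤ k → dist (p j) (p k) ≤ L * |r j - r k|)
    (hb : Bornology.IsBounded (range p)) :
    HasBoxDim (range p) (1 / (1 + α)) := by
  set d := 1 / (1 + α) with hd
  have hd0 : 0 < d := by positivity
  have hdα : d * α = 1 - d := by rw [hd]; field_simp; ring
  have hpos : ∀ᶠ ε : ℝ in 𝓝[>] 0, 0 < ε := self_mem_nhdsWithin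
  have hone : ∀ᶠ ε : ℝ in 𝓝[>] 0, ε < 1 :=
    eventually_nhdsWithin_of_eventually_nhds (gt_mem_nhds one_pos)
  refine hasBoxDim_of_volume_bounds (c := (c / 2) ^ d / 2 * Real.pi)
    (C := (3 + K + C) * (Real.pi * (L + 1) ^ 2)) hd0 (by positivity) hb ?_ ?_
  · have hinf : Tendsto (fun ε : ℝ => (c / (2 * ε)) ^ d) (𝓝[>] 0) atTop := by
      refine (tendsto_rpow_atTop hd0).comp ?_
      have : Tendsto (fun ε : ℝ => c / 2 * ε⁻¹) (𝓝[>] 0) atTop :=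
        tendsto_inv_nhdsGT_zero.const_mul_atTop (by positivity)
      refine this.congr fun ε => ?_
      rw [← div_eq_mul_inv, div_div]
    filter_upwards [hpos, hinf.eventually_ge_atTop (2 * ((K : ℝ) + 2))] with ε hε hbig
    -- `X` solves c X^(-(1+α)) = 2ε: up to this index the guaranteed gaps are at least 2ε, so these
    -- points carry disjoint discs.
    set X := (c / (2 * ε)) ^ d with hX
    set M := ⌊X⌋₊ with hM
    have hX0 : 0 ≤ X := by positivity
    have hMX : (M : ℝ) ≤ X := Nat.floor_le hX0
    have hXM : X < M + 1 := Nat.lt_floor_add_one X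
    have hdec : ∀ j k, K ≤ j → 0 < j → j ≤ k → r k ≤ r j := by
      intro j k hj hj0 hjk
      induction k, hjk using Nat.le_induction with
      | base => exact le_rfl
      | succ k hk ih =>
        have := h2 k (hj.trans hk) (hj0.trans_le hk)
        have : (0 : ℝ) ≤ c * (k : ℝ) ^ (-(1 + α)) := by positivity
        linarith
    have hsep : ∀ j ∈ Finset.Ico (K + 1) (M + 1), ∀ k ∈ Finset.Ico (K + 1) (M + 1), j < k →
        2 * ε ≤ dist (p j) (p k) := by
      intro j hj k hk hjk
      rw [Finset.mem_Ico] at hj hk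
      have hj0 : (0 : ℝ) < j := by
        have : 0 < j := by omega
        exact_mod_cast this
      have hjX : (j : ℝ) ≤ X := by
        refine le_trans ?_ hMX
        have : j ≤ M := by omega
        exact_mod_cast this
      have e1 : 2 * ε ≤ c * (j : ℝ) ^ (-(1 + α)) := by
        have : (j : ℝ) ^ (1 + α) ≤ c / (2 * ε) := by
          calc (j : ℝ) ^ (1 + α) ≤ X ^ (1 + α) :=
                Real.rpow_le_rpow hj0.le hjX (by positivity)
            _ = c / (2 * ε) := by
                rw [hX, ← Real.rpow_mul (by positivity), hd, one_div,
                  inv_mul_cancel₀ (by positivity), Real.rpow_one]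
        rw [Real.rpow_neg hj0.le, ← div_eq_mul_inv, le_div_iff₀ (by positivity)]
        rw [le_div_iff₀ (by positivity)] at this
        linarith
      have e2 := h2 j (by omega) (by omega)
      have e3 := hdec (j + 1) k (by omega) (by omega) hjk
      have e4 := h3 j k (by omega) (by omega)
      have e5 := le_abs_self (r j - r k)
      linarith
    refine le_trans (ENNReal.ofReal_le_ofReal ?_)
      (le_volume_thickening hε (Finset.Ico (K + 1) (M + 1)) (fun k _ => mem_range_self k) hsep)
    have hKM : K + 1 ≤ M + 1 := by
      have : (K : ℝ) < M + 1 := by linarith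
      exact_mod_cast this
    rw [Nat.card_Ico, Nat.cast_sub hKM]
    push_cast
    have hXe : X = (c / 2) ^ d * ε ^ (-d) := by
      rw [hX, Real.rpow_neg hε.le, ← Real.inv_rpow hε.le,
        ← Real.mul_rpow (by positivity) (by positivity)]
      congr 1
      field_simp
    have e6 : ε ^ ((2 : ℝ) - d) = ε ^ (-d) * ε ^ 2 := by
      rw [← Real.rpow_natCast, ← Real.rpow_add hε]
      congr 1
      push_cast
      ring
    rw [e6]
    calc (c / 2) ^ d / 2 * Real.pi * (ε ^ (-d) * ε ^ 2)
        = X / 2 * (Real.pi * ε ^ 2) := by rw [hXe]; ring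
      _ ≤ _ := by
          refine mul_le_mul_of_nonneg_right ?_ (by positivity)
          linarith
  · filter_upwards [hpos, hone] with ε hε hε1
    -- `Y` balances the two contributions: about `Y` initial points are covered one by one, and the
    -- rest lies in an interval of length C Y^(-α) = C Y ε, because dα = 1 - d.
    set Y := ε ^ (-d) with hY
    have hY1 : 1 ≤ Y := Real.one_le_rpow_of_pos_of_le_one_of_nonpos hε hε1.le (by linarith)
    set M := K + ⌈Y⌉₊ with hM
    have hMY : (M : ℝ) ≤ K + Y + 1 := by
      have := (Nat.ceil_lt_add_one (by linarith : 0 ≤ Y)).le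
      rw [hM]
      push_cast
      linarith
    have hYM : Y ≤ M := by
      have := Nat.le_ceil Y
      rw [hM]
      push_cast
      linarith [(Nat.cast_nonneg K : (0 : ℝ) ≤ K)]
    have htail : ∀ k, M ≤ k → r k / ε ≤ C * Y := by
      intro k hk
      have hYk : Y ≤ k := hYM.trans (by exact_mod_cast hk)
      have hk0 : 0 < k := by
        have : (0 : ℝ) < k := by linarith
        exact_mod_cast this
      rw [div_le_iff₀ hε]
      refine (h1 k (by omega) hk0).trans ?_
      rw [mul_assoc]
      refine mul_le_mul_of_nonneg_left ?_ hC.le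
      calc (k : ℝ) ^ (-α) ≤ Y ^ (-α) :=
            Real.rpow_le_rpow_of_nonpos (by linarith) hYk (by linarith)
        _ = Y * ε := by
            rw [hY, ← Real.rpow_mul hε.le, neg_mul_neg, hdα, sub_eq_add_neg, Real.rpow_add hε,
              Real.rpow_one, mul_comm]
    -- Initial points form singleton classes; tail points are sorted by the interval of length ε
    -- that contains `r k`.
    set cl : ℕ → ℕ := fun k => if k < M then k else M + ⌊r k / ε⌋₊ with hcl
    have hclM : ∀ k, cl k < M + (⌊C * Y⌋₊ + 1) := by
      intro k
      simp only [hcl]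
      split_ifs with h
      · omega
      · have := Nat.floor_le_floor (htail k (not_lt.1 h))
        omega
    have hclose : ∀ j k, cl j = cl k → dist (p j) (p k) ≤ L * ε := by
      intro j k hjk
      simp only [hcl] at hjk
      have hnn : 0 ≤ L * ε := by positivity
      split_ifs at hjk with h h' h'
      · simpa [hjk] using hnn
      · omega
      · omega
      · have hj : K ≤ j := by omega
        have hk : K ≤ k := by omega
        refine (h4 j k hj hk).trans (mul_le_mul_of_nonneg_left ?_ hL)
        have hf : ⌊r j / ε⌋₊ = ⌊r k / ε⌋₊ := by omega
        have a1 := Nat.floor_le (div_nonneg (h0 j hj) hε.le)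
        have a2 := Nat.floor_le (div_nonneg (h0 k hk) hε.le)
        have a3 := Nat.lt_floor_add_one (r j / ε)
        have a4 := Nat.lt_floor_add_one (r k / ε)
        rw [hf] at a1 a3
        have : |r j / ε - r k / ε| ≤ 1 := by
          rw [abs_le]
          constructor <;> linarith
        rwa [← sub_div, abs_div, abs_of_pos hε, div_le_one hε] at this
    refine (volume_thickening_range_le hε hL cl hclM hclose).trans (ENNReal.ofReal_le_ofReal ?_)
    have e6 : ε ^ ((2 : ℝ) - d) = Y * ε ^ 2 := by
      rw [hY, ← Real.rpow_natCast, ← Real.rpow_add hε]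
      congr 1
      push_cast
      ring
    push_cast
    rw [e6]
    have hfl := Nat.floor_le (by positivity : 0 ≤ C * Y)
    calc ((M : ℝ) + (⌊C * Y⌋₊ + 1)) * (Real.pi * ((L + 1) * ε) ^ 2)
        ≤ ((3 + K + C) * Y) * (Real.pi * ((L + 1) * ε) ^ 2) := by
          refine mul_le_mul_of_nonneg_right ?_ (by positivity)
          nlinarith [(Nat.cast_nonneg K : (0 : ℝ) ≤ K)]
      _ = _ := by ring

/-! ### L'Hôpital's rule and the decay law r' = Λ rⁿ⁺¹. -/

/-- **L'Hôpital's rule** at infinity for a quotient whose denominator is unbounded. -/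
theorem tendsto_div_atTop_of_hasDerivAt {f g f' g' : ℝ → ℝ} {l : ℝ}
    (hf : ∀ᶠ t in atTop, HasDerivAt f (f' t) t) (hg : ∀ᶠ t in atTop, HasDerivAt g (g' t) t)
    (hg' : ∀ᶠ t in atTop, g' t ≠ 0) (hgt : Tendsto (fun t => |g t|) atTop atTop)
    (h : Tendsto (fun t => f' t / g' t) atTop (𝓝 l)) :
    Tendsto (fun t => f t / g t) atTop (𝓝 l) := by
  rw [Metric.tendsto_atTop']
  intro ε hε
  have hclose : ∀ᶠ t in atTop, |f' t - l * g' t| ≤ ε / 2 * |g' t| := by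
    filter_upwards [hg', h.eventually (Metric.closedBall_mem_nhds l (half_pos hε))] with t h0 ht
    rw [Real.dist_eq] at ht
    have : f' t - l * g' t = (f' t / g' t - l) * g' t := by field_simp
    rw [this, abs_mul]
    exact mul_le_mul_of_nonneg_right ht (abs_nonneg _)
  obtain ⟨T, hT⟩ := eventually_atTop.1 (hf.and (hg.and (hg'.and hclose)))
  -- Cauchy's mean value theorem with `T` fixed; the terms at `T` are absorbed later because |g|
  -- tends to infinity.
  have hmean : ∀ t, T < t → |(f t - f T) - l * (g t - g T)| ≤ ε / 2 * |g t - g T| := by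
    intro t ht
    obtain ⟨c, hc, hcd⟩ := exists_ratio_hasDerivAt_eq_ratio_slope f f' ht
      (fun s hs => (hT s hs.1).1.continuousAt.continuousWithinAt)
      (fun s hs => (hT s hs.1.le).1) g g'
      (fun s hs => (hT s hs.1).2.1.continuousAt.continuousWithinAt)
      (fun s hs => (hT s hs.1.le).2.1)
    obtain ⟨-, -, hc0, hcε⟩ := hT c hc.1.le
    have e1 : ((f t - f T) - l * (g t - g T)) * g' c = (f' c - l * g' c) * (g t - g T) := by
      linear_combination -hcd
    have e2 := congrArg abs e1
    rw [abs_mul, abs_mul] at e2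
    refine le_of_mul_le_mul_right ?_ (abs_pos.2 hc0)
    rw [e2]
    calc _ ≤ ε / 2 * |g' c| * |g t - g T| := mul_le_mul_of_nonneg_right hcε (abs_nonneg _)
      _ = _ := by ring
  obtain ⟨T', hT'⟩ := eventually_atTop.1
    (hgt.eventually_gt_atTop (2 / ε * (|f T - l * g T| + ε / 2 * |g T|)))
  refine ⟨max T T', fun t ht => ?_⟩
  have h1 := hmean t (lt_of_le_of_lt (le_max_left _ _) ht)
  have h2 := hT' t ((le_max_right T T').trans ht.le)
  have h3 : 0 < |g t| := lt_of_le_of_lt (by positivity) h2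
  have h4 : |f T - l * g T| + ε / 2 * |g T| < ε / 2 * |g t| := by
    rw [div_mul_eq_mul_div, div_lt_iff₀ hε] at h2
    linarith
  have h5 : f t / g t - l = (f t - l * g t) / g t := by
    have : g t ≠ 0 := abs_pos.1 h3
    field_simp
  rw [Real.dist_eq, h5, abs_div, div_lt_iff₀ h3]
  have h6 : f t - l * g t = ((f t - f T) - l * (g t - g T)) + (f T - l * g T) := by ring
  have h7 := abs_add_le ((f t - f T) - l * (g t - g T)) (f T - l * g T)
  have h8 := abs_sub (g t) (g T)
  rw [h6]
  nlinarith

/-- A continuous function without zeros on a half-line has a constant sign there. -/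
theorem exists_sign_of_ne_zero {f : ℝ → ℝ} {T : ℝ} (hf : ContinuousOn f (Ici T))
    (h0 : ∀ t, T ≤ t → f t ≠ 0) : ∃ s : ℝ, (s = 1 ∨ s = -1) ∧ ∀ t, T ≤ t → 0 < s * f t := by
  have key : (∀ t, T ≤ t → 0 < f t) ∨ (∀ t, T ≤ t → f t < 0) := by
    by_contra hcon
    push Not at hcon
    obtain ⟨⟨x, hx, hfx⟩, y, hy, hfy⟩ := hcon
    obtain ⟨z, hz, hfz⟩ := isPreconnected_Ici.intermediate_value hx hy hf ⟨hfx, hfy⟩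
    exact h0 z hz hfz
  rcases key with h | h
  · exact ⟨1, Or.inl rfl, fun t ht => by simpa using h t ht⟩
  · exact ⟨-1, Or.inr rfl, fun t ht => by simpa using h t ht⟩

section Decay

variable {r Λ : ℝ → ℝ} {l : ℝ} {n : ℕ}

/-- If `r > 0` tends to zero and `r' = Λ rⁿ⁺¹` with `Λ → l ≠ 0`, then `(t rⁿ)⁻¹ → - n l`. -/
theorem tendsto_decay_inv (hn : n ≠ 0) (hr : ∀ᶠ t in atTop, 0 < r t)
    (hd : ∀ᶠ t in atTop, HasDerivAt r (Λ t * r t ^ (n + 1)) t)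
    (hΛ : Tendsto Λ atTop (𝓝 l)) :
    Tendsto (fun t => (r t ^ n)⁻¹ / t) atTop (𝓝 (-(n * l))) := by
  -- The derivative of r^(-n) is -nΛ, which converges to -nl; compare with t.
  refine tendsto_div_atTop_of_hasDerivAt (f' := fun t => -(n * Λ t)) (g' := fun _ => 1)
    ?_ (Eventually.of_forall fun t => hasDerivAt_id t) (by simp) tendsto_abs_atTop_atTop ?_
  · filter_upwards [hr, hd] with t h0 ht
    refine ((ht.fun_pow n).fun_inv (pow_ne_zero n h0.ne')).congr_deriv ?_
    obtain ⟨k, rfl⟩ := Nat.exists_eq_succ_of_ne_zero hn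
    have := h0.ne'
    simp only [Nat.succ_eq_add_one, Nat.add_sub_cancel]
    field_simp
    ring
  · simpa using (hΛ.const_mul (n : ℝ)).neg

/-- The sign is forced: the positive quantity (t rⁿ)⁻¹ converges to -nl, so l cannot be positive. -/
theorem decay_rate_neg (hn : n ≠ 0) (hr : ∀ᶠ t in atTop, 0 < r t)
    (hd : ∀ᶠ t in atTop, HasDerivAt r (Λ t * r t ^ (n + 1)) t)
    (hΛ : Tendsto Λ atTop (𝓝 l)) (hl : l ≠ 0) : l < 0 := by
  have h := tendsto_decay_inv hn hr hd hΛ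
  have h' : 0 ≤ -(n * l) := by
    refine ge_of_tendsto h ?_
    filter_upwards [hr, eventually_gt_atTop 0] with t h0 ht
    positivity
  have hn' : (0 : ℝ) < n := by exact_mod_cast Nat.pos_of_ne_zero hn
  exact lt_of_le_of_ne (by nlinarith) hl

theorem tendsto_decay (hn : n ≠ 0) (hr : ∀ᶠ t in atTop, 0 < r t)
    (hd : ∀ᶠ t in atTop, HasDerivAt r (Λ t * r t ^ (n + 1)) t)
    (hΛ : Tendsto Λ atTop (𝓝 l)) (hl : l ≠ 0) :
    Tendsto (fun t => t * r t ^ n) atTop (𝓝 (-(n * l))⁻¹) := by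
  have hn' : (n : ℝ) ≠ 0 := by exact_mod_cast hn
  refine ((tendsto_decay_inv hn hr hd hΛ).inv₀ (neg_ne_zero.2 (mul_ne_zero hn' hl))).congr ?_
  intro t
  rw [inv_div, div_inv_eq_mul]

/-- The displacement over a unit of time of a solution of `r' = Λ rⁿ⁺¹`. -/
theorem tendsto_decay_displacement (hn : n ≠ 0) (hr : ∀ᶠ t in atTop, 0 < r t)
    (hd : ∀ᶠ t in atTop, HasDerivAt r (Λ t * r t ^ (n + 1)) t)
    (hΛ : Tendsto Λ atTop (𝓝 l)) (hl : l ≠ 0) :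
    Tendsto (fun t => (r (t + 1) - r t) / r t ^ (n + 1)) atTop (𝓝 l) := by
  have hl0 := decay_rate_neg hn hr hd hΛ hl
  have hn' : (0 : ℝ) < n := by exact_mod_cast Nat.pos_of_ne_zero hn
  have hdec := tendsto_decay hn hr hd hΛ hl
  have hshift : Tendsto (fun t : ℝ => t + 1) atTop atTop :=
    tendsto_atTop_add_const_right _ _ tendsto_id
  have hlim : (-(n * l))⁻¹ ≠ 0 := inv_ne_zero (by nlinarith)
  -- Since t rⁿ has a nonzero limit, comparing it at t + 1 and at t leaves only the factor t / (t +
  -- 1).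
  have hratio_pow : Tendsto (fun t => (r (t + 1) / r t) ^ n) atTop (𝓝 1) := by
    have h1 := ((hdec.comp hshift).div hdec hlim)
    have h2 : Tendsto (fun t : ℝ => t / (t + 1)) atTop (𝓝 1) := by
      have h3 : Tendsto (fun t : ℝ => 1 - (t + 1)⁻¹) atTop (𝓝 (1 - 0)) :=
        tendsto_const_nhds.sub (tendsto_inv_atTop_zero.comp hshift)
      rw [sub_zero] at h3
      refine h3.congr' ?_
      filter_upwards [eventually_gt_atTop 0] with t ht
      field_simp
      ring
    rw [div_self hlim] at h1
    have h4 := h1.mul h2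
    rw [mul_one] at h4
    refine h4.congr' ?_
    filter_upwards [eventually_gt_atTop 0, hr] with t ht h0
    change (t + 1) * r (t + 1) ^ n / (t * r t ^ n) * (t / (t + 1)) = _
    rw [div_pow]
    field_simp
  have hratio : Tendsto (fun t => r (t + 1) / r t) atTop (𝓝 1) := by
    have h1 : Tendsto (fun t => ((r (t + 1) / r t) ^ n) ^ ((n : ℝ)⁻¹)) atTop
        (𝓝 (1 ^ ((n : ℝ)⁻¹))) :=
      hratio_pow.rpow_const (Or.inl one_ne_zero)
    rw [Real.one_rpow] at h1
    refine h1.congr' ?_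
    filter_upwards [hr, hshift.eventually hr] with t h0 h1
    exact Real.pow_rpow_inv_natCast (div_pos h1 h0).le hn
  obtain ⟨T, hT⟩ := eventually_atTop.1 (hr.and (hd.and (hΛ.eventually (gt_mem_nhds hl0))))
  have hanti : AntitoneOn r (Ici T) := by
    refine antitoneOn_of_deriv_nonpos (convex_Ici T)
      (fun t ht => (hT t ht).2.1.continuousAt.continuousWithinAt)
      (fun t ht => (hT t (interior_subset ht)).2.1.differentiableAt.differentiableWithinAt) ?_
    intro t ht
    obtain ⟨h0, h1, h2⟩ := hT t (interior_subset ht)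
    rw [h1.deriv]
    exact (mul_neg_of_neg_of_pos h2 (pow_pos h0 _)).le
  have hmvt : ∀ t, T ≤ t → ∃ ξ ∈ Ioo t (t + 1), Λ ξ * r ξ ^ (n + 1) = r (t + 1) - r t := by
    intro t ht
    obtain ⟨ξ, hξ, h⟩ := exists_hasDerivAt_eq_slope r (fun s => Λ s * r s ^ (n + 1))
      (lt_add_one t)
      (fun s hs => (hT s (ht.trans hs.1)).2.1.continuousAt.continuousWithinAt)
      (fun s hs => (hT s (ht.trans hs.1.le)).2.1)
    refine ⟨ξ, hξ, ?_⟩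
    simpa using h
  choose! ξ hξ hξd using hmvt
  have hξtop : Tendsto ξ atTop atTop := by
    refine tendsto_atTop_mono' _ ?_ tendsto_id
    filter_upwards [eventually_ge_atTop T] with t ht
    exact (hξ t ht).1.le
  -- `r` is eventually decreasing, so the mean value point is squeezed: r(t+1) / r(t) ≤ r(ξ) / r(t)
  -- ≤ 1.
  have hq : Tendsto (fun t => r (ξ t) / r t) atTop (𝓝 1) := by
    refine tendsto_of_tendsto_of_tendsto_of_le_of_le' hratio tendsto_const_nhds ?_ ?_
    · filter_upwards [eventually_ge_atTop T] with t ht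
      have := hξ t ht
      exact div_le_div_of_nonneg_right
        (hanti (ht.trans this.1.le) (by simp only [mem_Ici]; linarith) this.2.le) (hT t ht).1.le
    · filter_upwards [eventually_ge_atTop T] with t ht
      have := hξ t ht
      rw [div_le_one (hT t ht).1]
      exact hanti ht (ht.trans this.1.le) this.1.le
  have hfin := (hΛ.comp hξtop).mul (hq.pow (n + 1))
  rw [one_pow, mul_one] at hfin
  refine hfin.congr' ?_
  filter_upwards [eventually_ge_atTop T] with t ht
  rw [← hξd t ht, Function.comp_apply, div_pow, mul_div_assoc]

end Decay

/-! ### Uniqueness and global existence for differential equations. -/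

section ODE

variable {E : Type*} [NormedAddCommGroup E] [NormedSpace ℝ E]

/-- Two solutions of an autonomous equation with the same initial value agree as long as the first
one stays in the region where the vector field is `C¹`. -/
theorem IsIntegralCurveOn.eqOn_Icc_of_contDiffAt {X : E → E} {φ ψ : ℝ → E} {a b : ℝ}
    (hφ : IsIntegralCurveOn φ (fun _ => X) (Icc a b))
    (hψ : IsIntegralCurveOn ψ (fun _ => X) (Icc a b))
    (hX : ∀ t ∈ Icc a b, ContDiffAt ℝ 1 X (φ t)) (h : φ a = ψ a) : EqOn φ ψ (Icc a b) := by
  rcases lt_or_ge b a with hab | hab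
  · simp [Icc_eq_empty_of_lt hab]
  have hclosed : IsClosed ({t | φ t = ψ t} ∩ Icc a b) := by
    have := (hφ.continuousOn.prodMk hψ.continuousOn).preimage_isClosed_of_isClosed isClosed_Icc
      isClosed_diagonal
    rwa [inter_comm] at this
  -- Continuous induction: the coincidence set is closed, and local Lipschitz uniqueness at the
  -- common value extends it to the right.
  refine fun t ht => hclosed.Icc_subset_of_forall_mem_nhdsWithin h ?_ ht
  rintro t ⟨ht, hta, htb⟩
  have htm : t ∈ Icc a b := ⟨hta, htb.le⟩
  obtain ⟨K, U, hU, hlip⟩ := (hX t htm).exists_lipschitzOnWith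
  have hsub : Icc t b ⊆ Icc a b := Icc_subset_Icc_left hta
  have hIcc : Icc t b ∈ 𝓝[≥] t := Icc_mem_nhdsGE htb
  have hmem : ∀ {χ : ℝ → E}, IsIntegralCurveOn χ (fun _ => X) (Icc a b) → χ t = φ t →
      ∀ᶠ s in 𝓝[≥] t, χ s ∈ U := by
    intro χ hχ he
    have h1 : ContinuousWithinAt χ (Ici t) t :=
      (((hχ t htm).continuousWithinAt).mono hsub).mono_of_mem_nhdsWithin hIcc
    exact h1 (by rwa [he])
  obtain ⟨c, hc, hcU⟩ := (mem_nhdsGE_iff_exists_Icc_subset).1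
    (inter_mem (inter_mem (hmem hφ rfl) (hmem hψ ht.symm)) hIcc)
  have hder : ∀ {χ : ℝ → E}, IsIntegralCurveOn χ (fun _ => X) (Icc a b) →
      ∀ s ∈ Ico t c, HasDerivWithinAt χ (X (χ s)) (Ici s) s := by
    intro χ hχ s hs
    have hsb : s < b := lt_of_lt_of_le hs.2 (hcU ⟨le_of_lt hc, le_rfl⟩).2.2
    exact ((hχ s ⟨hta.trans hs.1, hsb.le⟩).mono (Icc_subset_Icc_left (hta.trans hs.1))
      ).mono_of_mem_nhdsWithin (Icc_mem_nhdsGE hsb)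
  have hsub' : Icc t c ⊆ Icc a b := fun s hs => hsub (hcU hs).2
  have heq := ODE_solution_unique_of_mem_Icc_right (v := fun _ => X) (s := fun _ => U) (K := K)
    (fun _ _ => hlip) (hφ.continuousOn.mono hsub') (hder hφ)
    (fun s hs => (hcU (Ico_subset_Icc_self hs)).1.1) (hψ.continuousOn.mono hsub') (hder hψ)
    (fun s hs => (hcU (Ico_subset_Icc_self hs)).1.2) ht
  exact mem_of_superset (Ioc_mem_nhdsGT hc) fun s hs => heq (Ioc_subset_Icc_self hs)

/-- A time-dependent field that is uniformly Lipschitz, and bounded on bounded time intervals, has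
a solution on the whole half-line. -/
theorem exists_integralCurveOn_Ici [CompleteSpace E] {f : ℝ → E → E} {K : NNReal} {t₀ : ℝ}
    (x₀ : E) (hlip : ∀ t, LipschitzWith K (f t)) (hcont : ∀ x, Continuous fun t => f t x)
    {C : ℝ → ℝ} (hbdd : ∀ T, ∀ t ∈ Icc t₀ T, ∀ x, ‖f t x‖ ≤ C T) :
    ∃ φ : ℝ → E, φ t₀ = x₀ ∧ ∀ t, t₀ ≤ t → HasDerivWithinAt φ (f t (φ t)) (Ici t₀) t := by
  have hex : ∀ T, t₀ ≤ T → ∃ φ : ℝ → E, φ t₀ = x₀ ∧ IsIntegralCurveOn φ f (Icc t₀ T) := by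
    intro T hT
    -- The bound holds for all x, so the ball may have radius C(T)(T - t₀), which no solution can
    -- leave by time T.
    have hpl : IsPicardLindelof f (tmin := t₀) (tmax := T) ⟨t₀, le_rfl, hT⟩ x₀
        ((C T).toNNReal * (T - t₀).toNNReal) 0 (C T).toNNReal K :=
      { lipschitzOnWith := fun t _ => (hlip t).lipschitzOnWith
        continuousOn := fun x _ => (hcont x).continuousOn
        norm_le := fun t ht x _ => (hbdd T t ht x).trans (Real.le_coe_toNNReal _)
        mul_max_le := by
          have h := sub_nonneg.2 hT
          simp [max_eq_left h, Real.coe_toNNReal _ h] }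
    exact hpl.exists_eq_forall_mem_Icc_hasDerivWithinAt₀
  choose! Φ hΦ0 hΦ using hex
  have hright : ∀ {T t}, t₀ ≤ T → t ∈ Ico t₀ T →
      HasDerivWithinAt (Φ T) (f t (Φ T t)) (Ici t) t := fun {T t} hT ht =>
    ((hΦ T hT t ⟨ht.1, ht.2.le⟩).mono (Icc_subset_Icc_left ht.1)).mono_of_mem_nhdsWithin
      (Icc_mem_nhdsGE ht.2)
  have huniq : ∀ S T, t₀ ≤ S → S ≤ T → EqOn (Φ S) (Φ T) (Icc t₀ S) := by
    intro S T hS hST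
    have hT := hS.trans hST
    exact ODE_solution_unique hlip (hΦ S hS).continuousOn (fun t ht => hright hS ht)
      ((hΦ T hT).continuousOn.mono (Icc_subset_Icc_right hST))
      (fun t ht => hright hT ⟨ht.1, ht.2.trans_le hST⟩) ((hΦ0 S hS).trans (hΦ0 T hT).symm)
  -- Using the solution up to t + 1 leaves room to the right of t for the derivative.
  refine ⟨fun t => Φ (t + 1) t, ?_, fun t ht => ?_⟩
  · simpa using hΦ0 (t₀ + 1) (by linarith)
  · have hmem : Icc t₀ (t + 1) ∈ 𝓝[Ici t₀] t :=
      inter_mem_nhdsWithin (Ici t₀) (Iic_mem_nhds (lt_add_one t))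
    have h1 : HasDerivWithinAt (Φ (t + 1)) (f t (Φ (t + 1) t)) (Ici t₀) t :=
      (hΦ (t + 1) (by linarith) t ⟨ht, by linarith⟩).mono_of_mem_nhdsWithin hmem
    refine h1.congr_of_eventuallyEq ?_ rfl
    filter_upwards [hmem] with s hs
    rcases le_total s t with hst | hst
    · exact huniq (s + 1) (t + 1) (by linarith [hs.1]) (by linarith) ⟨hs.1, by linarith⟩
    · exact (huniq (t + 1) (s + 1) (by linarith) (by linarith) hs).symm

end ODE

/-! ### Asymptotics of solutions that tend to the origin of the chart. -/

section Asymptotic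

variable {a b σ : ℝ} {m n : ℕ} {u v : ℝ → ℝ}

/-- The term `a xᵐ⁻ⁿ / y` of the cusp system, in the coordinates of the second chart. -/
noncomputable def cuspPerturbation (a : ℝ) (m n : ℕ) (u v : ℝ) : ℝ :=
  a * (u ^ ((m : ℤ) - n) * v ^ ((n : ℤ) + 1 - m))

/-- Taking n-th powers avoids fractional exponents: substituting v^n ≍ u^(n+1) leaves the exponent
n(m-n) + (n+1)(n+1-m) = 2n+1-m > 0 of u. -/
theorem tendsto_cuspPerturbation (hmn : m < 2 * n + 1)
    (hu : ∀ᶠ t in atTop, u t ≠ 0) (hu0 : Tendsto u atTop (𝓝 0))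
    (hΘ : (fun t => v t ^ n) =Θ[atTop] fun t => u t ^ (n + 1)) :
    Tendsto (fun t => cuspPerturbation a m n (u t) (v t)) atTop (𝓝 0) := by
  have h1 := ((isTheta_refl (fun t => u t ^ ((m : ℤ) - n)) atTop).pow n).mul
    (hΘ.zpow ((n : ℤ) + 1 - m))
  have h2 : (fun t => (u t ^ ((m : ℤ) - n)) ^ n * (u t ^ (n + 1)) ^ ((n : ℤ) + 1 - m))
      =ᶠ[atTop] fun t => u t ^ (2 * n + 1 - m) := by
    filter_upwards [hu] with t ht
    rw [← zpow_natCast (u t ^ ((m : ℤ) - n)), ← zpow_natCast (u t) (n + 1), ← zpow_mul,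
      ← zpow_mul, ← zpow_add₀ ht, ← zpow_natCast]
    congr 1
    rw [Nat.cast_sub hmn.le]
    push_cast
    ring
  have h3 : Tendsto (fun t => u t ^ (2 * n + 1 - m)) atTop (𝓝 0) := by
    have := hu0.pow (2 * n + 1 - m)
    rwa [zero_pow (by omega)] at this
  have h4 := (h1.isBigO.trans_eventuallyEq h2).trans_tendsto h3
  have h5 : Tendsto (fun t => cuspPerturbation a m n (u t) (v t) ^ n) atTop (𝓝 0) := by
    have := h4.const_mul (a ^ n)
    rw [mul_zero] at this
    refine this.congr fun t => ?_
    rw [cuspPerturbation, mul_pow, mul_pow, ← zpow_natCast (v t) n, ← zpow_mul,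
      ← zpow_natCast (v t ^ _) n, ← zpow_mul, mul_comm (n : ℤ)]
  rw [Metric.tendsto_nhds] at h5 ⊢
  intro ε hε
  filter_upwards [h5 (ε ^ n) (pow_pos hε n)] with t ht
  rw [dist_zero_right] at ht ⊢
  rw [norm_pow] at ht
  exact lt_of_pow_lt_pow_left₀ n hε.le ht

/-- The quotient is y / x^(n+1) with y = 1/v, x = u/v. In (u/v)' the terms with E and b cancel,
leaving σ v^(n-1), so the quotient of the derivatives of y and x^(n+1) is (E + b) / (n+1). -/
theorem tendsto_chart2_slope (hmn : m < 2 * n + 1) (hn : n ≠ 0) (hσ : σ ≠ 0)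
    (hu : ∀ᶠ t in atTop, u t ≠ 0) (hv : ∀ᶠ t in atTop, v t ≠ 0)
    (hu0 : Tendsto u atTop (𝓝 0)) (hv0 : Tendsto v atTop (𝓝 0))
    (hΘ : (fun t => v t ^ n) =Θ[atTop] fun t => u t ^ (n + 1))
    (hud : ∀ᶠ t in atTop, HasDerivAt u (σ * (v t ^ n - u t ^ (n + 1) *
      cuspPerturbation a m n (u t) (v t) - b * u t ^ (n + 1))) t)
    (hvd : ∀ᶠ t in atTop, HasDerivAt v (-σ * (u t ^ n * v t *
      (cuspPerturbation a m n (u t) (v t) + b))) t) :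
    Tendsto (fun t => v t ^ n / u t ^ (n + 1)) atTop (𝓝 (b / (n + 1))) := by
  have hE := tendsto_cuspPerturbation (a := a) hmn hu hu0 hΘ
  have hn1 : (n : ℝ) + 1 ≠ 0 := by positivity
  have hgt : Tendsto (fun t => |(u t / v t) ^ (n + 1)|) atTop atTop := by
    obtain ⟨C, hC, hle⟩ := hΘ.1.exists_pos
    have h1 : Tendsto (fun t => |(v t)⁻¹| * C⁻¹) atTop atTop := by
      refine Tendsto.atTop_mul_const (by positivity) ?_
      have h0 : Tendsto v atTop (𝓝[≠] 0) := tendsto_nhdsWithin_iff.2 ⟨hv0, hv⟩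
      exact tendsto_norm_cobounded_atTop.comp (tendsto_inv₀_nhdsNE_zero.comp h0)
    refine tendsto_atTop_mono' _ ?_ h1
    filter_upwards [hv, hle.bound] with t h0 ht
    rw [Real.norm_eq_abs, Real.norm_eq_abs] at ht
    have h2 : 0 < |v t| := abs_pos.2 h0
    rw [abs_inv, abs_pow, abs_div, div_pow, ← abs_pow, ← mul_inv, inv_eq_one_div,
      div_le_div_iff₀ (by positivity) (by positivity), pow_succ |v t|, ← abs_pow (v t)]
    nlinarith
  refine (tendsto_div_atTop_of_hasDerivAt (f := fun t => (v t)⁻¹)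
    (g := fun t => (u t / v t) ^ (n + 1))
    (f' := fun t => σ * (u t ^ n / v t) * (cuspPerturbation a m n (u t) (v t) + b))
    (g' := fun t => σ * (u t ^ n / v t) * (n + 1)) (l := b / (n + 1)) ?_ ?_ ?_ hgt ?_).congr' ?_
  · filter_upwards [hv, hvd] with t h0 ht
    refine (ht.fun_inv h0).congr_deriv ?_
    field_simp
  · filter_upwards [hv, hvd, hud] with t h0 ht ht'
    refine ((ht'.fun_div ht h0).fun_pow (n + 1)).congr_deriv ?_
    obtain ⟨k, rfl⟩ := Nat.exists_eq_succ_of_ne_zero hn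
    simp only [Nat.succ_eq_add_one, Nat.add_sub_cancel, div_pow]
    push_cast
    field_simp
    ring
  · filter_upwards [hu, hv] with t h0 h1
    positivity
  · have h1 : Tendsto (fun t => (cuspPerturbation a m n (u t) (v t) + b) / (n + 1)) atTop
        (𝓝 ((0 + b) / (n + 1))) := (hE.add_const b).div_const _
    rw [zero_add] at h1
    refine h1.congr' ?_
    filter_upwards [hu, hv] with t h0 h1
    field_simp
  · filter_upwards [hu, hv] with t h0 h1
    rw [div_pow]
    field_simp
    ring

/-- The asymptotics of a solution of the equations of the second chart that tends to the origin
with `|v| ≃ |u| ^ ((n + 1) / n)`. -/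
theorem chart2_asymptotics (hb : b ≠ 0) (hmn : m < 2 * n + 1) (hn : n ≠ 0) (hσ : σ ≠ 0)
    (hu : ∀ᶠ t in atTop, u t ≠ 0) (hv : ∀ᶠ t in atTop, v t ≠ 0)
    (hu0 : Tendsto u atTop (𝓝 0)) (hv0 : Tendsto v atTop (𝓝 0))
    (hΘ : (fun t => v t ^ n) =Θ[atTop] fun t => u t ^ (n + 1))
    (hud : ∀ᶠ t in atTop, HasDerivAt u (σ * (v t ^ n - u t ^ (n + 1) *
      cuspPerturbation a m n (u t) (v t) - b * u t ^ (n + 1))) t)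
    (hvd : ∀ᶠ t in atTop, HasDerivAt v (-σ * (u t ^ n * v t *
      (cuspPerturbation a m n (u t) (v t) + b))) t) :
    ∃ s l L T : ℝ, (s = 1 ∨ s = -1) ∧ l < 0 ∧ 0 ≤ L ∧ (∀ t, T ≤ t → 0 < s * u t) ∧
      Tendsto (fun t => t * (s * u t) ^ n) atTop (𝓝 (-(n * l))⁻¹) ∧
      Tendsto (fun t => (s * u (t + 1) - s * u t) / (s * u t) ^ (n + 1)) atTop (𝓝 l) ∧
      ∀ t₁ t₂, T ≤ t₁ → T ≤ t₂ → |v t₁ - v t₂| ≤ L * |u t₁ - u t₂| := by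
  have hE := tendsto_cuspPerturbation (a := a) hmn hu hu0 hΘ
  have hw := tendsto_chart2_slope hmn hn hσ hu hv hu0 hv0 hΘ hud hvd
  obtain ⟨T₁, hT₁⟩ := eventually_atTop.1 (hu.and hud)
  obtain ⟨s, hs, hsu⟩ := exists_sign_of_ne_zero (f := u) (T := T₁)
    (fun t ht => (hT₁ t ht).2.continuousAt.continuousWithinAt) (fun t ht => (hT₁ t ht).1)
  have hs2 : s * s = 1 := by rcases hs with rfl | rfl <;> norm_num
  have hs0 : s ≠ 0 := by rintro rfl; norm_num at hs2
  have hsabs : |s| = 1 := by rcases hs with rfl | rfl <;> norm_num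
  have hspow : s ^ n * s ^ n = 1 := by rw [← mul_pow, hs2, one_pow]
  -- For r = s u with s² = 1 the signs combine to s · s^(n+1) = s^n.
  set Λ : ℝ → ℝ := fun t => s ^ n * (σ * (v t ^ n / u t ^ (n + 1) -
    cuspPerturbation a m n (u t) (v t) - b)) with hΛdef
  set l := s ^ n * (σ * (b / (n + 1) - 0 - b)) with hldef
  have hΛ : Tendsto Λ atTop (𝓝 l) := (((hw.sub hE).sub_const b).const_mul σ).const_mul _
  have hl0 : l ≠ 0 := by
    have hn' : (n : ℝ) ≠ 0 := by exact_mod_cast hn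
    have : b / (n + 1) - 0 - b = -(b * n / (n + 1)) := by field_simp; ring
    rw [hldef, this]
    exact mul_ne_zero (pow_ne_zero _ hs0) (mul_ne_zero hσ (by
      have : (n : ℝ) + 1 ≠ 0 := by positivity
      exact neg_ne_zero.2 (div_ne_zero (mul_ne_zero hb hn') this)))
  have hr : ∀ᶠ t in atTop, 0 < s * u t := eventually_atTop.2 ⟨T₁, hsu⟩
  have hrd : ∀ᶠ t in atTop, HasDerivAt (fun t => s * u t) (Λ t * (s * u t) ^ (n + 1)) t := by
    filter_upwards [hu, hud] with t h0 ht
    refine (ht.const_mul s).congr_deriv ?_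
    have e : Λ t * (s * u t) ^ (n + 1) = (s ^ n * s ^ n) * s * (σ * (v t ^ n / u t ^ (n + 1) -
      cuspPerturbation a m n (u t) (v t) - b) * u t ^ (n + 1)) := by
      simp only [hΛdef]
      ring
    rw [e, hspow]
    field_simp
  have hlneg := decay_rate_neg hn hr hrd hΛ hl0
  -- |v|^n = O(|u|^(n+1)) is o(|u|^n).
  have hvu : ∀ᶠ t in atTop, |v t| ≤ s * u t := by
    have h1 : (fun t => v t ^ n) =o[atTop] fun t => u t ^ n := by
      refine hΘ.1.trans_isLittleO ?_
      have h2 : (fun t => u t ^ n * u t) =o[atTop] fun t => u t ^ n * (1 : ℝ) :=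
        (isBigO_refl _ _).mul_isLittleO ((isLittleO_one_iff ℝ).2 hu0)
      simpa [pow_succ] using h2
    filter_upwards [h1.bound one_pos, hr] with t ht h0
    have hsu' : |u t| = s * u t := by
      rw [← abs_of_pos h0, abs_mul, hsabs, one_mul]
    rw [one_mul, norm_pow, norm_pow, Real.norm_eq_abs, Real.norm_eq_abs, hsu'] at ht
    exact le_of_pow_le_pow_left₀ hn h0.le ht
  have hEb : ∀ᶠ t in atTop, |cuspPerturbation a m n (u t) (v t) + b| ≤ |b| + 1 := by
    have h1 := (hE.add_const b).abs
    rw [zero_add] at h1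
    exact (h1.eventually (gt_mem_nhds (lt_add_one |b|))).mono fun t ht => ht.le
  -- Eventually |v'| ≤ |σ| (|b| + 1) r^(n+1) while -r' ≥ (-l/2) r^(n+1), where r = s u; `L` is the
  -- quotient of the two constants.
  set L := 2 * |σ| * (|b| + 1) / (-l) with hL
  have hL0 : 0 ≤ L := by
    have : 0 < -l := by linarith
    positivity
  obtain ⟨T, hT⟩ := eventually_atTop.1 (hr.and (hrd.and (hvd.and (hvu.and (hEb.and
    (hΛ.eventually (gt_mem_nhds (by linarith : l < l / 2))))))))
  have hder : ∀ t, T ≤ t → |-σ * (u t ^ n * v t * (cuspPerturbation a m n (u t) (v t) + b))| ≤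
      -(L * (Λ t * (s * u t) ^ (n + 1))) := by
    intro t ht
    obtain ⟨h0, -, -, h1, h2, h3⟩ := hT t ht
    have hsu' : |u t| = s * u t := by
      rw [← abs_of_pos h0, abs_mul, hsabs, one_mul]
    rw [abs_mul, abs_mul, abs_mul, abs_neg, abs_pow, hsu']
    calc |σ| * ((s * u t) ^ n * |v t| * |cuspPerturbation a m n (u t) (v t) + b|)
        ≤ |σ| * ((s * u t) ^ n * (s * u t) * (|b| + 1)) := by gcongr
      _ = L * (-(l / 2) * (s * u t) ^ (n + 1)) := by
          rw [hL]
          have : -l ≠ 0 := by linarith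
          field_simp
          ring
      _ ≤ L * (-Λ t * (s * u t) ^ (n + 1)) := by
          refine mul_le_mul_of_nonneg_left ?_ hL0
          exact mul_le_mul_of_nonneg_right (by linarith) (by positivity)
      _ = _ := by ring
  -- |v'| ≤ -L r' makes both v + L r and -v + L r decreasing, which is the Lipschitz bound.
  have hanti : ∀ κ : ℝ, |κ| = 1 → AntitoneOn (fun t => κ * v t + L * (s * u t)) (Ici T) := by
    intro κ hκ
    have hd : ∀ t, T ≤ t → HasDerivAt (fun t => κ * v t + L * (s * u t))
        (κ * (-σ * (u t ^ n * v t * (cuspPerturbation a m n (u t) (v t) + b))) +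
          L * (Λ t * (s * u t) ^ (n + 1))) t := fun t ht =>
      ((hT t ht).2.2.1.const_mul κ).add ((hT t ht).2.1.const_mul L)
    refine antitoneOn_of_deriv_nonpos (convex_Ici T)
      (fun t ht => (hd t ht).continuousAt.continuousWithinAt)
      (fun t ht => (hd t (interior_subset ht)).differentiableAt.differentiableWithinAt) ?_
    intro t ht
    rw [(hd t (interior_subset ht)).deriv]
    have h1 := hder t (interior_subset ht)
    have h2 := le_abs_self
      (κ * (-σ * (u t ^ n * v t * (cuspPerturbation a m n (u t) (v t) + b))))
    rw [abs_mul, hκ, one_mul] at h2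
    linarith
  have hlip : ∀ t₁ t₂, T ≤ t₁ → t₁ ≤ t₂ → |v t₁ - v t₂| ≤ L * |u t₁ - u t₂| := by
    intro t₁ t₂ h1 h2
    have e1 := hanti 1 (by norm_num) h1 (h1.trans h2) h2
    have e2 := hanti (-1) (by norm_num) h1 (h1.trans h2) h2
    simp only at e1 e2
    have e3 : L * (s * (u t₁ - u t₂)) ≤ L * |u t₁ - u t₂| := by
      refine mul_le_mul_of_nonneg_left ((le_abs_self _).trans ?_) hL0
      rw [abs_mul, hsabs, one_mul]
    rw [abs_le]
    constructor <;> linarith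
  refine ⟨s, l, L, T, hs, hlneg, hL0, fun t ht => (hT t ht).1, tendsto_decay hn hr hrd hΛ hl0,
    tendsto_decay_displacement hn hr hrd hΛ hl0, fun t₁ t₂ h1 h2 => ?_⟩
  rcases le_total t₁ t₂ with h | h
  · exact hlip t₁ t₂ h1 h
  · rw [abs_sub_comm, abs_sub_comm (u t₁)]
    exact hlip t₂ t₁ h2 h

end Asymptotic

/-! ### Coordinates of the plane and regularity of the chart field. -/

theorem hasDerivAt_plane_iff {f : ℝ → Plane} {f' : Plane} {t : ℝ} :
    HasDerivAt f f' t ↔ ∀ i, HasDerivAt (fun s => f s i) (f' i) t := by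
  rw [← hasDerivWithinAt_univ, hasDerivWithinAt_iff_hasFDerivWithinAt, hasFDerivWithinAt_euclidean]
  refine forall_congr' fun i => ?_
  rw [← hasDerivWithinAt_univ, hasDerivWithinAt_iff_hasFDerivWithinAt]
  refine iff_of_eq ?_
  congr 1

theorem plane_dist_le (p q : Plane) : dist p q ≤ |p 0 - q 0| + |p 1 - q 1| := by
  rw [EuclideanSpace.dist_eq, Fin.sum_univ_two, Real.dist_eq, Real.dist_eq]
  exact (Real.sqrt_le_left (by positivity)).2 (by
    nlinarith [abs_nonneg (p 0 - q 0), abs_nonneg (p 1 - q 1)])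

theorem abs_coord_sub_le_dist (p q : Plane) (i : Fin 2) : |p i - q i| ≤ dist p q := by
  rw [dist_eq_norm]
  exact PiLp.norm_apply_le (p - q) i

section Field

variable {a b : ℝ} {m n : ℕ} {p : Plane}

theorem chart2Field_fst (hu : p 0 ≠ 0) : chart2Field a b m n p 0 =
    p 1 ^ n - p 0 ^ (n + 1) * cuspPerturbation a m n (p 0) (p 1) - b * p 0 ^ (n + 1) := by
  simp only [chart2Field, cuspPerturbation, PiLp.toLp_apply, Matrix.cons_val_zero]
  rw [zpow_sub₀ hu, zpow_natCast, zpow_natCast]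
  field_simp
  ring

theorem chart2Field_snd (hu : p 0 ≠ 0) (hv : p 1 ≠ 0) : chart2Field a b m n p 1 =
    -(p 0 ^ n * p 1 * (cuspPerturbation a m n (p 0) (p 1) + b)) := by
  simp only [chart2Field, cuspPerturbation, PiLp.toLp_apply, Matrix.cons_val_zero,
    Matrix.cons_val_one]
  have : (n : ℤ) - m + 2 = ((n : ℤ) + 1 - m) + 1 := by ring
  rw [zpow_sub₀ hu, zpow_natCast, zpow_natCast, this, zpow_add₀ hv, zpow_one]
  field_simp
  ring

/-- The integer exponents of v may be negative, so smoothness is claimed only off the line at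
infinity; a separatrix stays there. -/
theorem contDiffAt_chart2Field (hv : p 1 ≠ 0) : ContDiffAt ℝ 1 (chart2Field a b m n) p := by
  have hz : ∀ z : ℤ, ContDiffAt ℝ 1 (fun q : Plane => q 1 ^ z) p := by
    intro z
    have h1 : ContDiffAt ℝ 1 (fun q : Plane => q 1) p := by fun_prop
    obtain ⟨k, rfl | rfl⟩ := z.eq_nat_or_neg
    · simpa only [zpow_natCast] using h1.pow k
    · simp only [zpow_neg, zpow_natCast]
      exact (h1.pow k).inv (pow_ne_zero k hv)
  have h0 := hz ((n : ℤ) + 1 - m)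
  have h1 := hz ((n : ℤ) - m + 2)
  rw [contDiffAt_euclidean]
  intro i
  fin_cases i <;>
    simp only [chart2Field, PiLp.toLp_apply, Matrix.cons_val_zero, Matrix.cons_val_one,
      Fin.zero_eta, Fin.mk_one] <;> fun_prop

end Field

/-! ### The unit-time map and the displacement order along a curve. -/

/-- The unit-time map follows any solution that stays where the field is `C¹`. -/
theorem unitTimeMap_eq {X : Plane → Plane} {γ : ℝ → Plane}
    (hγ : IsIntegralCurveOn γ (fun _ => X) (Ici 0)) (hX : ∀ t, 0 ≤ t → ContDiffAt ℝ 1 X (γ t))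
    {t : ℝ} (ht : 0 ≤ t) : unitTimeMap X (γ t) = γ (t + 1) := by
  have hshift : IsIntegralCurveOn (fun s => γ (t + s)) (fun _ => X) (Icc 0 1) := by
    intro s hs
    have h1 := hγ (t + s) (add_nonneg ht hs.1)
    have h2 : HasDerivWithinAt (fun s => t + s) 1 (Icc 0 1) s :=
      (hasDerivWithinAt_id s _).const_add t
    have h3 := h1.scomp s h2 fun r hr => add_nonneg ht hr.1
    simpa using! h3
  have hex : ∃ δ : ℝ → Plane, δ 0 = γ t ∧ IsIntegralCurveOn δ (fun _ => X) (Icc 0 1) :=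
    ⟨_, by simp, hshift⟩
  rw [unitTimeMap, dif_pos hex]
  obtain ⟨h0, h1⟩ := hex.choose_spec
  -- The solution selected in the definition is arbitrary; uniqueness identifies it with the shifted
  -- curve.
  exact (hshift.eqOn_Icc_of_contDiffAt h1 (fun s hs => hX _ (add_nonneg ht hs.1))
    (by simpa using h0.symm) ⟨zero_le_one, le_rfl⟩).symm

/-- Near its limit a half-trajectory that does not pass through the limit is traversed at large
times. -/
theorem nhdsWithin_image_Ici_eq_map {α : Type*} [TopologicalSpace α] [T2Space α] {γ : ℝ → α}
    {x : α} (hγ : ContinuousOn γ (Ici 0)) (hne : ∀ t, 0 ≤ t → γ t ≠ x)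
    (hlim : Tendsto γ atTop (𝓝 x)) : 𝓝[γ '' Ici 0] x = map γ atTop := by
  refine le_antisymm (fun s hs => ?_) ?_
  · obtain ⟨T, hT⟩ := mem_atTop_sets.1 (mem_map.1 hs)
    -- The arc up to time T is compact and misses x, so its complement is a neighbourhood of x.
    have hcl : IsClosed (γ '' Icc 0 T) :=
      (isCompact_Icc.image_of_continuousOn (hγ.mono Icc_subset_Ici_self)).isClosed
    have hx : x ∉ γ '' Icc 0 T := by
      rintro ⟨t, ht, h⟩
      exact hne t ht.1 h
    refine mem_nhdsWithin.2 ⟨_, hcl.isOpen_compl, hx, ?_⟩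
    rintro _ ⟨hy, t, ht, rfl⟩
    by_contra hcon
    refine hy ⟨t, ⟨ht, ?_⟩, rfl⟩
    by_contra htT
    exact hcon (hT t (not_le.1 htT).le)
  · refine tendsto_nhdsWithin_iff.2 ⟨hlim, ?_⟩
    filter_upwards [eventually_ge_atTop 0] with t ht
    exact mem_image_of_mem γ ht

/-- The order of the displacement along a curve that accumulates at the origin is unique. -/
theorem HasDisplacementOrder.unique {U : Plane → Plane} {Γ : Set Plane} {M N : ℕ}
    [(𝓝[Γ] (0 : Plane)).NeBot] (hΓ : ∀ᶠ p in 𝓝[Γ] (0 : Plane), p 0 ≠ 0)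
    (hM : HasDisplacementOrder U Γ M) (hN : HasDisplacementOrder U Γ N) : M = N := by
  have key : ∀ {M N : ℕ}, HasDisplacementOrder U Γ M → HasDisplacementOrder U Γ N → ¬ M < N := by
    rintro M N ⟨c, hc, hM⟩ ⟨c', -, hN⟩ hlt
    -- The quotient of order M is the one of order N times u^(N-M), so its limit would be 0.
    have h0 : Tendsto (fun p : Plane => p 0 ^ (N - M)) (𝓝[Γ] 0) (𝓝 0) := by
      have h1 : Continuous fun p : Plane => p 0 ^ (N - M) := by fun_prop
      have h2 := h1.tendsto 0
      simp only [PiLp.zero_apply, zero_pow (Nat.sub_ne_zero_of_lt hlt)] at h2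
      exact h2.mono_left nhdsWithin_le_nhds
    have h1 := hN.mul h0
    rw [mul_zero] at h1
    refine hc (tendsto_nhds_unique (hM.congr' ?_) h1)
    filter_upwards [hΓ] with p hp
    rw [div_mul_eq_mul_div, div_eq_div_iff (pow_ne_zero _ hp) (pow_ne_zero _ hp), mul_assoc,
      ← pow_add]
    congr 2
    omega
  exact le_antisymm (not_lt.1 (key hN hM)) (not_lt.1 (key hM hN))

/-! ### Dimension and multiplicity of a separatrix. -/

section Separatrix

variable {a b σ : ℝ} {m n : ℕ} {γ : ℝ → Plane}

/-- The asymptotics along a half-trajectory of `± chart2Field` that is a separatrix at infinity. -/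
theorem separatrix_asymptotics (hb : b ≠ 0) (hmn : m < 2 * n + 1) (hn : n ≠ 0) (hσ : σ ≠ 0)
    (hγ : IsIntegralCurveOn γ (fun _ => σ • chart2Field a b m n) (Ici 0))
    (hv : ∀ t ∈ Ici (0 : ℝ), γ t 1 ≠ 0) (hlim : Tendsto γ atTop (𝓝 0))
    (hΘ : (fun t => γ t 1) =Θ[atTop] fun t => |γ t 0| ^ (((n : ℝ) + 1) / n)) :
    ∃ s l L T : ℝ, (s = 1 ∨ s = -1) ∧ l < 0 ∧ 0 ≤ L ∧ (∀ t, T ≤ t → 0 < s * γ t 0) ∧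
      Tendsto (fun t => t * (s * γ t 0) ^ n) atTop (𝓝 (-(n * l))⁻¹) ∧
      Tendsto (fun t => (s * γ (t + 1) 0 - s * γ t 0) / (s * γ t 0) ^ (n + 1)) atTop (𝓝 l) ∧
      ∀ t₁ t₂, T ≤ t₁ → T ≤ t₂ → |γ t₁ 1 - γ t₂ 1| ≤ L * |γ t₁ 0 - γ t₂ 0| := by
  have hn' : (n : ℝ) ≠ 0 := by exact_mod_cast hn
  have hcoord : ∀ i, Tendsto (fun t => γ t i) atTop (𝓝 0) := by
    intro i
    have h1 : Continuous fun p : Plane => p i := by fun_prop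
    exact (h1.tendsto' 0 0 rfl).comp hlim
  have hv' : ∀ᶠ t in atTop, γ t 1 ≠ 0 := eventually_atTop.2 ⟨0, hv⟩
  -- The asymptotics would force v = 0 wherever u = 0, since the exponent is nonzero.
  have hu' : ∀ᶠ t in atTop, γ t 0 ≠ 0 := by
    obtain ⟨C, hC⟩ := hΘ.1.bound
    filter_upwards [hC, hv'] with t ht h1 h0
    rw [h0, abs_zero, Real.zero_rpow (div_ne_zero (by positivity) hn'), norm_zero, mul_zero] at ht
    exact h1 (norm_le_zero_iff.1 ht)
  have hpow : (fun t => γ t 1 ^ n) =Θ[atTop] fun t => γ t 0 ^ (n + 1) := by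
    have h1 : (fun t => (|γ t 0| ^ (((n : ℝ) + 1) / n)) ^ n) = fun t => ‖γ t 0 ^ (n + 1)‖ := by
      funext t
      rw [← Real.rpow_natCast, ← Real.rpow_mul (abs_nonneg _), div_mul_cancel₀ _ hn', norm_pow,
        Real.norm_eq_abs, ← Real.rpow_natCast]
      push_cast
      rfl
    have h2 := hΘ.pow n
    rw [h1] at h2
    exact h2.trans (isTheta_refl _ _).norm_left
  have hder : ∀ᶠ t in atTop, HasDerivAt γ (σ • chart2Field a b m n (γ t)) t := by
    filter_upwards [eventually_gt_atTop 0] with t ht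
    exact (hγ t ht.le).hasDerivAt (Ici_mem_nhds ht)
  refine chart2_asymptotics (a := a) (b := b) (σ := σ) (m := m) (u := fun t => γ t 0)
    (v := fun t => γ t 1) hb hmn hn hσ hu' hv' (hcoord 0) (hcoord 1) hpow ?_ ?_
  · filter_upwards [hder, hu'] with t ht h0
    refine (hasDerivAt_plane_iff.1 ht 0).congr_deriv ?_
    rw [PiLp.smul_apply, smul_eq_mul, chart2Field_fst h0]
  · filter_upwards [hder, hu', hv'] with t ht h0 h1
    refine (hasDerivAt_plane_iff.1 ht 1).congr_deriv ?_
    rw [PiLp.smul_apply, smul_eq_mul, chart2Field_snd h0 h1]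
    ring

/-- The box dimension of a sequence of equidistant times on a curve with the asymptotics of a
separatrix at infinity. -/
theorem hasBoxDim_of_asymptotics (hn : n ≠ 0) {s l L T : ℝ} (hs : s = 1 ∨ s = -1) (hl : l < 0)
    (hL : 0 ≤ L) (hpos : ∀ t, T ≤ t → 0 < s * γ t 0)
    (hdec : Tendsto (fun t => t * (s * γ t 0) ^ n) atTop (𝓝 (-(n * l))⁻¹))
    (hdisp : Tendsto (fun t => (s * γ (t + 1) 0 - s * γ t 0) / (s * γ t 0) ^ (n + 1)) atTop (𝓝 l))
    (hlip : ∀ t₁ t₂, T ≤ t₁ → T ≤ t₂ → |γ t₁ 1 - γ t₂ 1| ≤ L * |γ t₁ 0 - γ t₂ 0|)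
    (hlim : Tendsto γ atTop (𝓝 0)) {t₀ : ℝ} (ht₀ : 0 ≤ t₀) :
    HasBoxDim (range fun k : ℕ => γ (t₀ + k)) (1 - 1 / ((n : ℝ) + 1)) := by
  have hn0 : (0 : ℝ) < n := by exact_mod_cast Nat.pos_of_ne_zero hn
  have hdim : 1 - 1 / ((n : ℝ) + 1) = 1 / (1 + (n : ℝ)⁻¹) := by field_simp; ring
  have hsabs : |s| = 1 := by rcases hs with rfl | rfl <;> norm_num
  set D := (-(n * l))⁻¹ with hD
  have hD0 : 0 < D := inv_pos.2 (by nlinarith)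
  obtain ⟨T₁, hT₁⟩ := eventually_atTop.1
    ((hdec.eventually (gt_mem_nhds (by linarith : D < 2 * D))).and
      ((hdec.eventually (lt_mem_nhds (by linarith : D / 2 < D))).and
        (hdisp.eventually (gt_mem_nhds (by linarith : l < l / 2)))))
  have htend : Tendsto (fun k : ℕ => t₀ + (k : ℝ)) atTop atTop :=
    tendsto_atTop_add_const_left _ _ tendsto_natCast_atTop_atTop
  obtain ⟨K, hK⟩ := eventually_atTop.1 ((htend.eventually_ge_atTop (max T T₁)).and
    (tendsto_natCast_atTop_atTop.eventually_ge_atTop t₀))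
  have hKT : ∀ k, K ≤ k → T ≤ t₀ + k := fun k hk => (le_max_left _ _).trans (hK k hk).1
  have hKT₁ : ∀ k, K ≤ k → T₁ ≤ t₀ + k := fun k hk => (le_max_right _ _).trans (hK k hk).1
  rw [hdim]
  -- For large k, k ≤ t₀ + k ≤ 2k and D/2 < t rⁿ < 2D give D/(4k) ≤ rⁿ ≤ 2D/k; the gap is at least
  -- (-l/2) r^(n+1). The factor 1 + L bounds distance in the plane by distance in u.
  refine hasBoxDim_range_of_gaps (r := fun k => s * γ (t₀ + k) 0) (α := (n : ℝ)⁻¹)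
    (C := (2 * D) ^ (n : ℝ)⁻¹) (c := -l / 2 * (D / 4) ^ (1 + (n : ℝ)⁻¹)) (L := 1 + L) (K := K)
    (by positivity) (by positivity) (mul_pos (by linarith) (by positivity)) (by linarith)
    ?_ ?_ ?_ ?_ ?_ ?_
  · exact fun k hk => (hpos _ (hKT k hk)).le
  · intro k hk hk0
    have hk0' : (0 : ℝ) < k := by exact_mod_cast hk0
    have h0 := hpos _ (hKT k hk)
    have h1 := (hT₁ _ (hKT₁ k hk)).1
    have h2 : (s * γ (t₀ + k) 0) ^ n ≤ 2 * D * (k : ℝ)⁻¹ := by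
      rw [← div_eq_mul_inv, le_div_iff₀ hk0']
      have : 0 ≤ t₀ * (s * γ (t₀ + k) 0) ^ n := by positivity
      nlinarith
    calc s * γ (t₀ + k) 0 = ((s * γ (t₀ + k) 0) ^ n) ^ (n : ℝ)⁻¹ :=
          (Real.pow_rpow_inv_natCast h0.le hn).symm
      _ ≤ (2 * D * (k : ℝ)⁻¹) ^ (n : ℝ)⁻¹ := by gcongr
      _ = _ := by
          rw [Real.mul_rpow (by positivity) (by positivity), Real.inv_rpow hk0'.le,
            ← Real.rpow_neg hk0'.le]
  · intro k hk hk0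
    have hk0' : (0 : ℝ) < k := by exact_mod_cast hk0
    have h0 := hpos _ (hKT k hk)
    obtain ⟨-, h1, h2⟩ := hT₁ _ (hKT₁ k hk)
    have h3 : D / 4 * (k : ℝ)⁻¹ ≤ (s * γ (t₀ + k) 0) ^ n := by
      rw [← div_eq_mul_inv, div_le_iff₀ hk0']
      have h4 : t₀ * (s * γ (t₀ + k) 0) ^ n ≤ k * (s * γ (t₀ + k) 0) ^ n :=
        mul_le_mul_of_nonneg_right (hK k hk).2 (by positivity)
      nlinarith
    have h5 : (D / 4) ^ (1 + (n : ℝ)⁻¹) * (k : ℝ) ^ (-(1 + (n : ℝ)⁻¹)) ≤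
        (s * γ (t₀ + k) 0) ^ (n + 1) := by
      calc (D / 4) ^ (1 + (n : ℝ)⁻¹) * (k : ℝ) ^ (-(1 + (n : ℝ)⁻¹))
          = (D / 4 * (k : ℝ)⁻¹) ^ (1 + (n : ℝ)⁻¹) := by
            rw [Real.mul_rpow (by positivity) (by positivity), Real.inv_rpow hk0'.le,
              ← Real.rpow_neg hk0'.le]
        _ ≤ ((s * γ (t₀ + k) 0) ^ n) ^ (1 + (n : ℝ)⁻¹) := by gcongr
        _ = _ := by
            rw [Real.rpow_add (by positivity), Real.rpow_one,
              Real.pow_rpow_inv_natCast h0.le hn, pow_succ]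
    rw [div_lt_iff₀ (by positivity)] at h2
    have h6 : -l / 2 * (D / 4) ^ (1 + (n : ℝ)⁻¹) * (k : ℝ) ^ (-(1 + (n : ℝ)⁻¹)) ≤
        -l / 2 * (s * γ (t₀ + k) 0) ^ (n + 1) := by
      rw [mul_assoc]
      exact mul_le_mul_of_nonneg_left h5 (by linarith)
    push_cast
    rw [← add_assoc]
    linarith
  · intro j k hj hk
    rw [← mul_sub, abs_mul, hsabs, one_mul]
    exact abs_coord_sub_le_dist _ _ 0
  · intro j k hj hk
    rw [← mul_sub, abs_mul, hsabs, one_mul]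
    have := hlip _ _ (hKT j hj) (hKT k hk)
    have := plane_dist_le (γ (t₀ + j)) (γ (t₀ + k))
    linarith
  · exact Metric.isBounded_range_of_tendsto _ (hlim.comp htend)

/-- The unit-time map shifts the parameter by 1, and approaching the origin on Γ means t → ∞; both
claims thus become the asymptotics of γ at large times. -/
theorem separatrix_hasBoxDim_and_multiplicity (hb : b ≠ 0) (hmn : m < 2 * n + 1) (hn : n ≠ 0)
    {Y : Plane → Plane} (hY : Y = chart2Field a b m n ∨ Y = -chart2Field a b m n) {Γ : Set Plane}
    (hΓ : IsSeparatrixToInfinity Y n Γ) :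
    (∀ p ∈ Γ, HasBoxDim (orbitSet (unitTimeMap Y) p) (1 - 1 / ((n : ℝ) + 1))) ∧
      (∀ k : ℕ, HasMultiplicity (unitTimeMap Y) Γ k ↔ k = n / 2) := by
  obtain ⟨γ, hγ, hv, hlim, rfl, hΘ⟩ := hΓ
  obtain ⟨σ, hσ, rfl⟩ : ∃ σ : ℝ, σ ≠ 0 ∧ Y = σ • chart2Field a b m n := by
    rcases hY with rfl | rfl
    · exact ⟨1, one_ne_zero, (one_smul _ _).symm⟩
    · exact ⟨-1, by norm_num, by rw [neg_smul, one_smul]⟩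
  set Y := σ • chart2Field a b m n with hYdef
  have hne : ∀ t, 0 ≤ t → γ t ≠ 0 := fun t ht h => hv t ht (by rw [h]; rfl)
  have hmap := nhdsWithin_image_Ici_eq_map hγ.continuousOn hne hlim
  have hU : ∀ t, 0 ≤ t → unitTimeMap Y (γ t) = γ (t + 1) := fun t ht =>
    unitTimeMap_eq hγ (fun r hr => (contDiffAt_chart2Field (hv r hr)).const_smul σ) ht
  rw [hmap] at hΘ
  obtain ⟨s, l, L, T, hs, hl, hL, hpos, hdec, hdisp, hlip⟩ :=
    separatrix_asymptotics hb hmn hn hσ hγ hv hlim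
      ⟨isBigO_map.1 hΘ.1, isBigO_map.1 hΘ.2⟩
  have hs0 : s ≠ 0 := by rcases hs with rfl | rfl <;> norm_num
  refine ⟨?_, ?_⟩
  · rintro _ ⟨t₀, ht₀, rfl⟩
    have horb : orbitSet (unitTimeMap Y) (γ t₀) = range fun k : ℕ => γ (t₀ + k) := by
      refine congrArg range (funext fun k => ?_)
      induction k with
      | zero => simp
      | succ k ih =>
        have hk : 0 ≤ t₀ + (k : ℝ) := add_nonneg ht₀ k.cast_nonneg
        rw [Function.iterate_succ_apply', ih, hU _ hk, add_assoc, Nat.cast_succ]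
    rw [horb]
    exact hasBoxDim_of_asymptotics hn hs hl hL hpos hdec hdisp hlip hlim ht₀
  · have hord : HasDisplacementOrder (unitTimeMap Y) (γ '' Ici 0) (n + 1) := by
      refine ⟨s ^ n * l, mul_ne_zero (pow_ne_zero _ hs0) hl.ne, ?_⟩
      rw [hmap, tendsto_map'_iff]
      refine (hdisp.const_mul (s ^ n)).congr' ?_
      filter_upwards [eventually_ge_atTop 0, eventually_ge_atTop T] with t h0 h1
      have hu : γ t 0 ≠ 0 := right_ne_zero_of_mul (hpos t h1).ne'
      rw [Function.comp_apply, hU t h0, mul_pow, pow_succ s]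
      field_simp
    have hne' : ∀ᶠ p in 𝓝[γ '' Ici 0] (0 : Plane), p 0 ≠ 0 := by
      rw [hmap, eventually_map]
      filter_upwards [eventually_ge_atTop T] with t ht
      exact right_ne_zero_of_mul (hpos t ht).ne'
    have : (𝓝[γ '' Ici 0] (0 : Plane)).NeBot := by
      rw [hmap]
      infer_instance
    intro k
    constructor
    · rintro (h | h)
      · have := h.unique hne' hord
        omega
      · have := h.unique hne' hord
        omega
    -- n + 1 equals 2k + 1 for even n and 2k + 2 for odd n.
    · rintro rfl
      rcases Nat.even_or_odd n with h | h
      · left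
        rwa [Nat.two_mul_div_two_of_even h]
      · right
        have : 2 * (n / 2) + 2 = n + 1 := by
          have := Nat.two_mul_div_two_add_one_of_odd h
          omega
        rwa [this]

end Separatrix

/-! ### Existence of a separatrix. -/

/-- The equation `dy/dx = (n + 1) B xⁿ + a xᵐ / y` of the orbits of the cusp system has a solution
of the size of `xⁿ⁺¹` near infinity. -/
theorem exists_cusp_orbit {B : ℝ} (a : ℝ) (hB : 0 < B) {m n : ℕ} (hmn : m < 2 * n + 1) :
    ∃ x₀ : ℝ, 1 ≤ x₀ ∧ ∃ y : ℝ → ℝ,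
      (∀ x, x₀ < x → HasDerivAt y ((n + 1) * B * x ^ n + a * x ^ m / y x) x) ∧
      ∀ x, x₀ ≤ x → B / 2 * x ^ (n + 1) ≤ y x ∧ y x ≤ 2 * B * x ^ (n + 1) := by
  -- With y = B x^(n+1) + z the equation is z' = a x^m / y. Flooring the denominator at (B/2)
  -- x^(n+1) and x at 1 makes it globally Lipschitz in z.
  set f : ℝ → ℝ → ℝ := fun x z => a * (max x 1) ^ m /
    max (B * (max x 1) ^ (n + 1) + z) (B / 2 * (max x 1) ^ (n + 1)) with hf
  -- Beyond 4|a| / B², with m ≤ 2n, the truncated right side is at most the derivative of (B/2)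
  -- x^(n+1).
  set x₀ := max 1 (4 * |a| / B ^ 2) with hx₀
  have hx₀1 : 1 ≤ x₀ := le_max_left _ _
  have hlip : ∀ x, LipschitzWith (4 * |a| / B ^ 2).toNNReal (f x) := by
    intro x
    refine LipschitzWith.of_dist_le_mul fun z z' => ?_
    rw [Real.coe_toNNReal _ (by positivity), Real.dist_eq, Real.dist_eq]
    simp only [hf]
    set X := max x 1
    have hX : 1 ≤ X := le_max_right _ _
    set c := B / 2 * X ^ (n + 1) with hc
    have hc0 : 0 < c := by positivity
    set A := max (B * X ^ (n + 1) + z) c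
    set A' := max (B * X ^ (n + 1) + z') c
    have hA : c ≤ A := le_max_right _ _
    have hA' : c ≤ A' := le_max_right _ _
    have hA0 : 0 < A := hc0.trans_le hA
    have hA0' : 0 < A' := hc0.trans_le hA'
    have hAA : |A' - A| ≤ |z - z'| := by
      refine (abs_max_sub_max_le_abs _ _ c).trans_eq ?_
      rw [add_sub_add_left_eq_sub, abs_sub_comm]
    have h1 : a * X ^ m / A - a * X ^ m / A' = a * X ^ m * (A' - A) / (A * A') := by
      field_simp
    have h2 : B ^ 2 / 4 * X ^ m ≤ A * A' := by
      calc B ^ 2 / 4 * X ^ m ≤ B ^ 2 / 4 * X ^ (2 * (n + 1)) := by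
            gcongr
            omega
        _ = c * c := by rw [hc]; ring
        _ ≤ A * A' := by gcongr
    rw [h1, abs_div, abs_mul, abs_mul, abs_pow, abs_of_pos (by linarith : 0 < X),
      abs_of_pos (mul_pos hA0 hA0'), div_le_iff₀ (by positivity)]
    calc |a| * X ^ m * |A' - A| ≤ |a| * X ^ m * |z - z'| := by gcongr
      _ = 4 * |a| / B ^ 2 * |z - z'| * (B ^ 2 / 4 * X ^ m) := by field_simp
      _ ≤ _ := by gcongr
  have hcont : ∀ z, Continuous fun x => f x z := by
    intro z
    simp only [hf]
    refine Continuous.div (by fun_prop) (by fun_prop) fun x => ?_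
    have h1 : 0 < max x 1 := lt_max_of_lt_right one_pos
    exact (lt_max_of_lt_right (by positivity)).ne'
  have hbound : ∀ x, x₀ ≤ x → ∀ z, ‖f x z‖ ≤ B / 2 * ((n + 1) * x ^ n) := by
    intro x hx z
    have hx1 : 1 ≤ x := hx₀1.trans hx
    have hxa : 4 * |a| / B ^ 2 ≤ x := (le_max_right _ _).trans hx
    rw [div_le_iff₀ (by positivity)] at hxa
    simp only [hf, max_eq_left hx1]
    set c := B / 2 * x ^ (n + 1) with hc
    have hc0 : 0 < c := by positivity
    have hA : c ≤ max (B * x ^ (n + 1) + z) c := le_max_right _ _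
    have hA0 := hc0.trans_le hA
    rw [Real.norm_eq_abs, abs_div, abs_mul, abs_pow, abs_of_pos (by linarith : 0 < x),
      abs_of_pos hA0, div_le_iff₀ hA0]
    calc |a| * x ^ m ≤ |a| * x ^ (2 * n) := by
          gcongr
          omega
      _ ≤ x * B ^ 2 / 4 * x ^ (2 * n) := by gcongr; linarith
      _ = B / 2 * (1 * x ^ n) * c := by rw [hc]; ring
      _ ≤ B / 2 * ((n + 1) * x ^ n) * c := by
          gcongr
          linarith [(Nat.cast_nonneg n : (0 : ℝ) ≤ n)]
      _ ≤ _ := by gcongr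
  obtain ⟨F, hF0, hF⟩ := exists_integralCurveOn_Ici (t₀ := x₀) (0 : ℝ) hlip hcont
    (C := fun T => B / 2 * ((n + 1) * T ^ n)) (by
      intro T x hx z
      refine (hbound x hx.1 z).trans ?_
      have := hx.2
      have : 0 ≤ x := by linarith [hx.1]
      gcongr)
  -- Comparison with (B/2) x^(n+1) shows a posteriori that the floor in the denominator is never
  -- active.
  have hFle : ∀ x, x₀ ≤ x → |F x| ≤ B / 2 * x ^ (n + 1) := by
    intro x hx
    have h1 := image_norm_le_of_norm_deriv_right_le_deriv_boundary (a := x₀) (b := x) (f := F)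
      (f' := fun x => f x (F x)) (B := fun x => B / 2 * x ^ (n + 1))
      (B' := fun x => B / 2 * ((n + 1) * x ^ n))
      (fun s hs => ((hF s hs.1).continuousWithinAt).mono Icc_subset_Ici_self)
      (fun s hs => (hF s hs.1).mono (Ici_subset_Ici.2 hs.1))
      (by rw [hF0, norm_zero]; positivity)
      (fun s => by simpa using (hasDerivAt_pow (n + 1) s).const_mul (B / 2))
      (fun s hs => hbound s hs.1 _)
    exact h1 ⟨hx, le_rfl⟩
  refine ⟨x₀, hx₀1, fun x => B * x ^ (n + 1) + F x, fun x hx => ?_, fun x hx => ?_⟩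
  · have hx1 : 1 ≤ x := hx₀1.trans hx.le
    have h1 := (hF x hx.le).hasDerivAt (Ici_mem_nhds hx)
    have h2 : f x (F x) = a * x ^ m / (B * x ^ (n + 1) + F x) := by
      simp only [hf, max_eq_left hx1]
      rw [max_eq_left]
      linarith [(abs_le.1 (hFle x hx.le)).1]
    rw [h2] at h1
    refine (((hasDerivAt_pow (n + 1) x).const_mul B).add h1).congr_deriv ?_
    push_cast
    ring
  · have h1 := abs_le.1 (hFle x hx)
    have : 0 ≤ B * x ^ (n + 1) := by
      have : 0 ≤ x := by linarith
      positivity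
    constructor <;> linarith [h1.1, h1.2]

/-- The solution of `X' = 1 / g(X)` for a continuous function `g` that is bounded below by a
positive constant. -/
theorem exists_time_change {g : ℝ → ℝ} {δ : ℝ} (hg : Continuous g) (hδ : 0 < δ)
    (hgδ : ∀ x, δ ≤ g x) (x₀ : ℝ) : ∃ X : ℝ → ℝ, X 0 = x₀ ∧ Monotone X ∧
      Tendsto X atTop atTop ∧ ∀ t, HasDerivAt X (g (X t))⁻¹ t := by
  -- `X` is the inverse of the elapsed time τ, a bijection of the line because its slope is at least
  -- δ.
  set τ : ℝ → ℝ := fun x => ∫ s in x₀..x, g s with hτ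
  have hτd : ∀ x, HasDerivAt τ (g x) x := fun x => (hg.integral_hasStrictDerivAt x₀ x).hasDerivAt
  have hτ0 : τ x₀ = 0 := intervalIntegral.integral_same
  have hmono : StrictMono τ := by
    refine strictMono_of_deriv_pos fun x => ?_
    rw [(hτd x).deriv]
    exact hδ.trans_le (hgδ x)
  have hgrow : Monotone fun x => τ x - δ * x := by
    have hd : ∀ x, HasDerivAt (fun x => τ x - δ * x) (g x - δ) x := fun x => by
      simpa using (hτd x).fun_sub ((hasDerivAt_id' x).const_mul δ)
    refine monotone_of_deriv_nonneg (fun x => (hd x).differentiableAt) fun x => ?_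
    rw [(hd x).deriv]
    linarith [hgδ x]
  have hτc : Continuous τ := continuous_iff_continuousAt.2 fun x => (hτd x).continuousAt
  have hlin : ∀ x, δ * x + -(δ * x₀) = δ * (x - x₀) := fun x => by ring
  have htop : Tendsto τ atTop atTop := by
    refine tendsto_atTop_mono' _ ?_
      (tendsto_atTop_add_const_right _ (-(δ * x₀)) (tendsto_id.const_mul_atTop hδ))
    filter_upwards [eventually_ge_atTop x₀] with x hx
    have := hgrow hx
    simp only [hτ0, id] at this ⊢
    linarith
  have hbot : Tendsto τ atBot atBot := by
    refine tendsto_atBot_mono' _ ?_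
      (tendsto_atBot_add_const_right _ (-(δ * x₀)) (tendsto_id.const_mul_atBot hδ))
    filter_upwards [eventually_le_atBot x₀] with x hx
    have := hgrow hx
    simp only [hτ0, id] at this ⊢
    linarith
  set e := hmono.orderIsoOfSurjective τ (hτc.surjective htop hbot) with he
  have hτe : ∀ t, τ (e.symm t) = t := fun t => e.apply_symm_apply t
  refine ⟨e.symm, ?_, e.symm.monotone, e.symm.tendsto_atTop, fun t => ?_⟩
  · exact hmono.injective (by rw [hτe, hτ0])
  · exact (hτd _).of_local_left_inverse e.symm.continuous.continuousAt
      (hδ.trans_le (hgδ _)).ne' (Eventually.of_forall hτe)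

section Existence

variable {a b : ℝ} {m n : ℕ}

theorem cuspPerturbation_div {x y : ℝ} (hx : x ≠ 0) (hy : y ≠ 0) :
    cuspPerturbation a m n (x / y) y⁻¹ = a * x ^ m / (x ^ n * y) := by
  rw [cuspPerturbation, zpow_sub₀ (div_ne_zero hx hy), zpow_sub₀ (inv_ne_zero hy),
    zpow_add₀ (inv_ne_zero hy)]
  simp only [zpow_natCast, zpow_one, inv_pow, div_pow]
  field_simp

/-- There is a separatrix at infinity. -/
theorem exists_separatrix (hb : b ≠ 0) (hmn : m < 2 * n + 1) (hn : n ≠ 0) :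
    ∃ Y : Plane → Plane, (Y = chart2Field a b m n ∨ Y = -chart2Field a b m n) ∧
      ∃ Γ : Set Plane, IsSeparatrixToInfinity Y n Γ := by
  have hn0 : (0 : ℝ) < n := by exact_mod_cast Nat.pos_of_ne_zero hn
  obtain ⟨ς, hς, hςb⟩ : ∃ ς : ℝ, (ς = 1 ∨ ς = -1) ∧ ς * |b| = b := by
    rcases abs_choice b with h | h
    · exact ⟨1, Or.inl rfl, by rw [h, one_mul]⟩
    · exact ⟨-1, Or.inr rfl, by rw [h, neg_one_mul, neg_neg]⟩
  have hς2 : ς * ς = 1 := by rcases hς with rfl | rfl <;> norm_num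
  have hς0 : ς ≠ 0 := by rintro rfl; norm_num at hς2
  have hςabs : |ς| = 1 := by rcases hς with rfl | rfl <;> norm_num
  set B := |b| / (n + 1) with hBdef
  have hB : 0 < B := div_pos (abs_pos.2 hb) (by positivity)
  have hBn : (n + 1) * B = |b| := by rw [hBdef]; field_simp
  obtain ⟨x₀, hx₀, y, hyd, hyb⟩ := exists_cusp_orbit a hB hmn
  have hy1 : ∀ x, x₀ ≤ x → B / 2 ≤ y x := by
    intro x hx
    refine le_trans ?_ (hyb x hx).1
    have : 1 ≤ x ^ (n + 1) := one_le_pow₀ (hx₀.trans hx)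
    nlinarith
  -- Differentiability of `y` is known only beyond x₀; clamping at x₁ gives a function continuous on
  -- the whole line.
  set x₁ := x₀ + 1 with hx₁
  have hclamp : ∀ x, x₀ < max x x₁ := fun x => lt_of_lt_of_le (lt_add_one x₀) (le_max_right _ _)
  obtain ⟨X, hX0, hXmono, hXtop, hXd⟩ := exists_time_change
    (g := fun x => y (max x x₁) ^ (n - 1)) (δ := (B / 2) ^ (n - 1)) (by
      refine Continuous.pow (continuous_iff_continuousAt.2 fun x => ?_) _
      exact ContinuousAt.comp (f := fun x => max x x₁) (hyd _ (hclamp x)).continuousAt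
        (by fun_prop)) (by positivity)
    (fun x => pow_le_pow_left₀ (by positivity) (hy1 _ (hclamp x).le) _) x₁
  have hX : ∀ t, 0 ≤ t → x₁ ≤ X t := fun t ht => hX0.ge.trans (hXmono ht)
  have hX' : ∀ t, 0 ≤ t → x₀ < X t := fun t ht => lt_of_lt_of_le (lt_add_one x₀) (hX t ht)
  have hXpos : ∀ t, 0 ≤ t → 0 < X t := fun t ht => by linarith [hX' t ht]
  have hypos : ∀ t, 0 ≤ t → 0 < y (X t) := fun t ht =>
    lt_of_lt_of_le (by positivity) (hy1 _ (hX' t ht).le)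
  set γ : ℝ → Plane := fun t => !₂[X t / (ς * y (X t)), (ς * y (X t))⁻¹] with hγ
  have hγ0 : ∀ t, γ t 0 = X t / (ς * y (X t)) := fun t => rfl
  have hγ1 : ∀ t, γ t 1 = (ς * y (X t))⁻¹ := fun t => rfl
  have hu0 : ∀ t, 0 ≤ t → |γ t 0| = X t / y (X t) := fun t ht => by
    rw [hγ0, abs_div, abs_mul, hςabs, one_mul, abs_of_pos (hXpos t ht), abs_of_pos (hypos t ht)]
  have hv0 : ∀ t, 0 ≤ t → |γ t 1| = (y (X t))⁻¹ := fun t ht => by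
    rw [hγ1, abs_inv, abs_mul, hςabs, one_mul, abs_of_pos (hypos t ht)]
  -- Multiplying x' = η by v^n = η^(-n), with η = ς y, gives x' = η^(1-n); this is σ y^(1-n), so σ
  -- decides whether X increases in forward or in reversed time.
  set σ := ς ^ (n - 1) with hσ
  have hσ1 : σ = 1 ∨ σ = -1 := by
    rcases hς with h | h
    · exact Or.inl (by rw [hσ, h, one_pow])
    · rw [hσ, h]; exact neg_one_pow_eq_or ℝ (n - 1)
  refine ⟨σ • chart2Field a b m n, ?_, γ '' Ici 0, γ, ?_, ?_, ?_, rfl, ?_⟩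
  · rcases hσ1 with h | h
    · exact Or.inl (by rw [h, one_smul])
    · exact Or.inr (by rw [h, neg_smul, one_smul])
  · intro t ht
    have ht : 0 ≤ t := ht
    have hx := (hXpos t ht).ne'
    have hy := (hypos t ht).ne'
    have hη : ς * y (X t) ≠ 0 := mul_ne_zero hς0 hy
    have hXd' : HasDerivAt X (σ / (ς * y (X t)) ^ (n - 1)) t := by
      refine (hXd t).congr_deriv ?_
      rw [max_eq_left (hX t ht), mul_pow, ← hσ]
      have : σ ≠ 0 := pow_ne_zero _ hς0
      field_simp
    have hηd : HasDerivAt (fun t => ς * y (X t)) ((b * X t ^ n + a * X t ^ m / (ς * y (X t))) *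
        (σ / (ς * y (X t)) ^ (n - 1))) t := by
      refine (((hyd _ (hX' t ht)).comp t hXd').const_mul ς).congr_deriv ?_
      rw [hBn, ← mul_assoc, mul_add, ← mul_assoc, hςb]
      congr 2
      field_simp
      linear_combination a * hς2
    have hpow : (ς * y (X t)) ^ n = (ς * y (X t)) ^ (n - 1) * (ς * y (X t)) :=
      (pow_sub_one_mul hn _).symm
    have hpow' : X t ^ n = X t ^ (n - 1) * X t := (pow_sub_one_mul hn _).symm
    have h0 : γ t 0 ≠ 0 := div_ne_zero hx hη
    have h1 : γ t 1 ≠ 0 := inv_ne_zero hη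
    refine (hasDerivAt_plane_iff.2 fun i => ?_).hasDerivWithinAt
    fin_cases i
    · refine (hXd'.fun_div hηd hη).congr_deriv ?_
      simp only [Fin.zero_eta, Pi.smul_apply, PiLp.smul_apply, smul_eq_mul]
      rw [chart2Field_fst h0, hγ0, hγ1, cuspPerturbation_div hx hη]
      generalize ς * y (X t) = η at *
      rw [div_pow, inv_pow, pow_succ η n, hpow]
      field_simp
      ring
    · refine (hηd.fun_inv hη).congr_deriv ?_
      simp only [Fin.mk_one, Pi.smul_apply, PiLp.smul_apply, smul_eq_mul]
      rw [chart2Field_snd h0 h1, hγ0, hγ1, cuspPerturbation_div hx hη]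
      generalize ς * y (X t) = η at *
      rw [div_pow, hpow]
      field_simp
      ring
  · exact fun t ht => inv_ne_zero (mul_ne_zero hς0 (hypos t ht).ne')
  · rw [tendsto_iff_dist_tendsto_zero]
    have h1 : Tendsto (fun t => 4 / B * (X t)⁻¹) atTop (𝓝 0) := by
      simpa using (tendsto_inv_atTop_zero.comp hXtop).const_mul (4 / B)
    refine squeeze_zero' (Eventually.of_forall fun _ => dist_nonneg) ?_ h1
    filter_upwards [eventually_ge_atTop 0] with t ht
    refine (plane_dist_le _ _).trans ?_
    simp only [PiLp.zero_apply, sub_zero]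
    -- As n ≥ 1, y is at least quadratic in X, so |u| + |v| = (X + 1) / y is at most 4 / (B X).
    have h2 : B / 2 * X t ^ 2 ≤ y (X t) := by
      refine le_trans ?_ (hyb _ (hX' t ht).le).1
      gcongr
      · linarith [hX' t ht]
      · omega
    have h3 : 1 ≤ X t := by linarith [hX' t ht]
    have h4 := hXpos t ht
    have h5 := hypos t ht
    rw [hu0 t ht, hv0 t ht, ← one_div, ← add_div, ← div_eq_mul_inv, div_div,
      div_le_div_iff₀ h5 (by positivity)]
    nlinarith
  · have hmem : ∀ᶠ p in 𝓝[γ '' Ici 0] (0 : Plane), p ∈ γ '' Ici 0 := self_mem_nhdsWithin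
    have hn1 : (0 : ℝ) ≤ (n : ℝ)⁻¹ := by positivity
    have hroot : ∀ p : Plane, (|p 1| ^ n) ^ (n : ℝ)⁻¹ = |p 1| := fun p =>
      Real.pow_rpow_inv_natCast (abs_nonneg _) hn
    have hroot' : ∀ p : Plane,
        (|p 0| ^ (n + 1)) ^ (n : ℝ)⁻¹ = |p 0| ^ (((n : ℝ) + 1) / n) := fun p => by
      rw [← Real.rpow_natCast, ← Real.rpow_mul (abs_nonneg _), div_eq_mul_inv]
      push_cast
      rfl
    -- On the curve |v|^n / |u|^(n+1) = y / X^(n+1), which lies between B/2 and 2B.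
    have hle : (fun p : Plane => |p 1| ^ n) =O[𝓝[γ '' Ici 0] 0] fun p => |p 0| ^ (n + 1) := by
      refine IsBigO.of_bound (2 * B) ?_
      filter_upwards [hmem] with p hp
      obtain ⟨t, ht, rfl⟩ := hp
      have h5 := hypos t ht
      have h4 := hXpos t ht
      rw [norm_pow, norm_pow, Real.norm_eq_abs, Real.norm_eq_abs, abs_abs, abs_abs, hu0 t ht,
        hv0 t ht, div_pow, inv_pow, mul_div_assoc', inv_eq_one_div,
        div_le_div_iff₀ (by positivity) (by positivity), one_mul, pow_succ (y _), mul_comm]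
      exact mul_le_mul_of_nonneg_right (hyb _ (hX' t ht).le).2 (by positivity)
    have hge : (fun p : Plane => |p 0| ^ (n + 1)) =O[𝓝[γ '' Ici 0] 0] fun p => |p 1| ^ n := by
      refine IsBigO.of_bound (2 / B) ?_
      filter_upwards [hmem] with p hp
      obtain ⟨t, ht, rfl⟩ := hp
      have h5 := hypos t ht
      have h4 := hXpos t ht
      rw [norm_pow, norm_pow, Real.norm_eq_abs, Real.norm_eq_abs, abs_abs, abs_abs, hu0 t ht,
        hv0 t ht, div_pow, inv_pow, ← div_eq_mul_inv,
        div_le_div_iff₀ (by positivity) (by positivity), pow_succ (y _)]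
      have := (hyb _ (hX' t ht).le).1
      have h6 : X t ^ (n + 1) ≤ 2 / B * y (X t) := by
        rw [div_mul_eq_mul_div, le_div_iff₀ hB]
        linarith
      calc _ ≤ 2 / B * y (X t) * y (X t) ^ n := by gcongr
        _ = _ := by ring
    have h1 := hle.rpow hn1 (Eventually.of_forall fun p => by positivity)
    have h2 := hge.rpow hn1 (Eventually.of_forall fun p => by positivity)
    simp only [hroot, hroot'] at h1 h2
    exact ⟨(isBigO_abs_left.1 h1), (isBigO_abs_right.1 h2)⟩

end Existence

theorem lemma5 (a b : ℝ) (m n : ℕ) (ha : a ≠ 0) (hb : b ≠ 0) (hm : Even m) (hm2 : 2 ≤ m)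
    (hmn : m < 2 * n + 1) :
    (∃ Y : Plane → Plane, (Y = chart2Field a b m n ∨ Y = -chart2Field a b m n) ∧
      ∃ Γ : Set Plane, IsSeparatrixToInfinity Y n Γ) ∧
    ∀ Y : Plane → Plane, (Y = chart2Field a b m n ∨ Y = -chart2Field a b m n) →
      ∀ Γ : Set Plane, IsSeparatrixToInfinity Y n Γ →
        (∀ p ∈ Γ, HasBoxDim (orbitSet (unitTimeMap Y) p) (1 - 1 / ((n : ℝ) + 1))) ∧
        (∀ k : ℕ, HasMultiplicity (unitTimeMap Y) Γ k ↔ k = n / 2) := by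
  have hn : n ≠ 0 := by omega
  exact ⟨exists_separatrix hb hmn hn,
    fun Y hY Γ hΓ => separatrix_hasBoxDim_and_multiplicity hb hmn hn hY hΓ⟩
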